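/- Consider a dual-hop amplify-and-forward relaying system with a single-antenna source, a single-antenna destination and a relay with $N\ge 1$ antennas, without co-channel interference. Let $P_s>0$ be the source power, $N_0>0$ the noise power, $\rho_1=P_s/N_0$, $d_1,d_2>0$ the source-relay and relay-destination distances, $\tau$ the path loss exponent, $\eta>0$ the energy conversion efficiency, $\theta\in(0,1)$ the power splitting ratio and $T>0$ the block duration. The channel vectors $\mathbf h_1$ ($N\times1$) and $\mathbf h_2$ ($1\times N$) are independent, with i.i.d. $\mathcal{CN}(0,1)$ entries. The relay receives $\mathbf y_r=\sqrt{(1-\theta)P_s/d_1^\tau}\,\mathbf h_1x+\mathbf n_r$, where $x$ has unit power and $\mathbf n_r$ is noise with covariance $N_0\mathbf I$; it harvests the energy $E_h=\frac{\eta\theta P_s}{d_1^\tau}\|\mathbf h_1\|^2\frac T2$, and the destination receives $y_d=\sqrt{1/d_2^\tau}\,\mathbf h_2\mathbf W\mathbf y_r+n_d$, where $n_d$ is independent noise of variance $N_0$, $\mathbf W=\omega\,\frac{\mathbf h_2^\dagger\mathbf h_1^\dagger}{\|\mathbf h_2\|\|\mathbf h_1\|}$, $\omega^2=P_r\big/\big(\frac{(1-\theta)P_s}{d_1^\tau}\|\mathbf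 h_1\|^2+N_0\big)$ and $P_r=E_h/(T/2)$. Let $\gamma$ be the resulting end-to-end signal-to-noise ratio for given $\mathbf h_1,\mathbf h_2$, let $C=\frac12\mathrm E[\log_2(1+\gamma)]$ be the ergodic capacity, and put $$\gamma_1=\frac{(1-\theta)\rho_1}{d_1^\tau}\|\mathbf h_1\|^2,\qquad \gamma_2=\frac{\eta\theta\rho_1}{d_1^\tau d_2^\tau}\|\mathbf h_2\|^2\|\mathbf h_1\|^2,\qquad C_{\gamma_i}=\tfrac12\mathrm E[\log_2(1+\gamma_i)].$$ Then all the expectations involved are finite, and $$C\le C_{\rm up}:=C_{\gamma_1}+C_{\gamma_2}-\tfrac12\log_2\!\left(1+e^{\mathrm E\ln\gamma_1}+e^{\mathrm E\ln\gamma_2}\right).$$ With $\alpha=\frac{d_1^\tau}{(1-\theta)\rho_1}$ and $\beta=\frac{d_1^\tau d_2^\tau}{\eta\theta\rho_1}$, $$C_{\gamma_1}=\frac{e^{\alpha}}{2\ln 2}\sum_{k=0}^{N-1}\alpha^k\,\Gamma(-k,\alpha),\qquad C_{\gamma_2}=\frac1{2\ln2}\,\frac1{\Gamma(N)}\sum_{m=0}^{N-1}\frac{\beta^m}{m!}\,G_{1,3}^{3,1}\!\left(\beta\,\middle|\begin{matrix}-m\\-m,\,N-m,\,0\end{matrix}\right),$$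 and $\mathrm E\ln\|\mathbf h_1\|^2=\mathrm E\ln\|\mathbf h_2\|^2=\psi(N)$, so that $$C_{\rm up}=\frac{e^{\alpha}}{2\ln 2}\sum_{k=0}^{N-1}\alpha^k\Gamma(-k,\alpha)+\frac1{2\ln2\,\Gamma(N)}\sum_{m=0}^{N-1}\frac{\beta^m}{m!}G_{1,3}^{3,1}\!\left(\beta\,\middle|\begin{matrix}-m\\-m,\,N-m,\,0\end{matrix}\right)-\frac12\log_2\!\left(1+\frac{(1-\theta)\rho_1}{d_1^\tau}e^{\psi(N)}+\frac{\eta\theta\rho_1}{d_1^\tau d_2^\tau}e^{2\psi(N)}\right).$$ Here $\Gamma(a,x)=\int_x^\infty t^{a-1}e^{-t}\,dt$ is the upper incomplete gamma function, $\psi=\Gamma'/\Gamma$ the digamma function and $G_{p,q}^{m,n}$ the Meijer $G$-function, given here by the Mellin-Barnes integral $G_{1,3}^{3,1}\big(z\,\big|\begin{smallmatrix}-m\\-m,\,N-m,\,0\end{smallmatrix}\big)=\frac1{2\pi i}\int_{c-i\infty}^{c+i\infty}\Gamma(-m-s)\Gamma(N-m-s)\Gamma(-s)\Gamma(1+m+s)z^s\,ds$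 with $-m-1<c<-m$. -/

import Mathlib

open MeasureTheory ProbabilityTheory
open scoped Matrix

noncomputable section

namespace EHRelay

/-! ### Special functions -/

/-- The upper incomplete gamma function `Γ(α, x) = ∫_x^∞ t^(α-1) e^(-t) dt`
(the integral converges for every real `α` when `x > 0`). -/
def upperGamma (α x : ℝ) : ℝ :=
  ∫ t in Set.Ioi x, t ^ (α - 1) * Real.exp (-t)

/-- The Mellin-Barnes integrand of the Meijer function `G_{p,q}^{m,n}(z | a; b)`:
the product of `Γ(b_j - s)` (`j ≤ m`) and `Γ(1 - a_j + s)` (`j ≤ n`), divided by the product of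
`Γ(1 - b_j + s)` (`j > m`) and `Γ(a_j - s)` (`j > n`), times `z ^ s`. Positions are counted from
`0` here, so that `j ≤ m` reads `(j : ℕ) < m`. -/
def meijerIntegrand {p q : ℕ} (m n : ℕ) (a : Fin p → ℂ) (b : Fin q → ℂ) (z s : ℂ) : ℂ :=
  ((∏ j : Fin q with Fin.val j < m, Complex.Gamma (b j - s)) *
      ∏ j : Fin p with Fin.val j < n, Complex.Gamma (1 - a j + s)) /
    ((∏ j : Fin q with m ≤ Fin.val j, Complex.Gamma (1 - b j + s)) *
      ∏ j : Fin p with n ≤ Fin.val j, Complex.Gamma (a j - s)) * z ^ s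

/-- The vertical line `Re s = c` separates the poles of `Γ(1 - a_j + s)`, `j ≤ n` (on its left),
from those of `Γ(b_j - s)`, `j ≤ m` (on its right). -/
def MeijerSeparates {p q : ℕ} (m n : ℕ) (a : Fin p → ℂ) (b : Fin q → ℂ) (c : ℝ) : Prop :=
  (∀ j : Fin p, (j : ℕ) < n → (a j).re - 1 < c) ∧ ∀ j : Fin q, (j : ℕ) < m → c < (b j).re

open Classical in
/-- The Meijer function `G_{p,q}^{m,n}(z | a; b)` as the Mellin-Barnes integral
`(1 / 2πi) ∫_L … ds` along a vertical line `L` that separates the two families of poles. This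
contour is the standard one when `p + q < 2 (m + n)` and `|arg z| < (m + n - (p + q) / 2) π`, and
the value does not depend on the separating line. The value `0` is assigned when
no vertical line separates the poles. On the line `ds = i dt`, hence the factor `1 / 2π`. -/
def meijerG {p q : ℕ} (m n : ℕ) (a : Fin p → ℂ) (b : Fin q → ℂ) (z : ℂ) : ℂ :=
  if h : ∃ c : ℝ, MeijerSeparates m n a b c then
    (1 / (2 * (Real.pi : ℂ))) *
      ∫ t : ℝ, meijerIntegrand m n a b z ((h.choose : ℂ) + (t : ℂ) * Complex.I)
  else 0

/-! ### The channel -/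

/-- The circularly symmetric complex Gaussian law `CN(0,1)`: independent real and imaginary
parts, each centred normal with variance `1/2`. -/
def complexNormal : Measure ℂ :=
  ((gaussianReal 0 (1 / 2)).prod (gaussianReal 0 (1 / 2))).map
    fun p : ℝ × ℝ => Complex.mk p.1 p.2

/-- The squared Frobenius norm of a complex vector. -/
def normSq {N : ℕ} (h : Fin N → ℂ) : ℝ := ∑ i, ‖h i‖ ^ 2

/-- The Frobenius norm of a complex vector. -/
def fnorm {N : ℕ} (h : Fin N → ℂ) : ℝ := Real.sqrt (normSq h)

/-! ### The dual-hop energy harvesting relaying system -/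

/-- The deterministic parameters of the system: source power `Ps`, noise power `N0`, block
duration `T`, distances `d1` (source to relay) and `d2` (relay to destination), path loss
exponent `τ`, energy conversion efficiency `η` and power splitting ratio `θ`. -/
structure System where
  Ps : ℝ
  N0 : ℝ
  T : ℝ
  d1 : ℝ
  d2 : ℝ
  τ : ℝ
  η : ℝ
  θ : ℝ

namespace System

variable (S : System) {N : ℕ}

/-- The admissible parameters. -/
def Admissible : Prop :=
  0 < S.Ps ∧ 0 < S.N0 ∧ 0 < S.T ∧ 0 < S.d1 ∧ 0 < S.d2 ∧ 0 < S.η ∧ 0 < S.θ ∧ S.θ < 1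

/-- `ρ₁ = Ps / N0`. -/
def rho : ℝ := S.Ps / S.N0

/-- The energy harvested by the relay during the first half of the block. -/
def harvestedEnergy (h₁ : Fin N → ℂ) : ℝ :=
  S.η * S.θ * S.Ps / S.d1 ^ S.τ * normSq h₁ * (S.T / 2)

/-- The transmit power of the relay: the harvested energy is spent during the second half of
the block. -/
def relayPower (h₁ : Fin N → ℂ) : ℝ := S.harvestedEnergy h₁ / (S.T / 2)

/-- The power constraint factor `ω` of the relay, which makes its average transmit power
(over the source message and the noise) equal to `relayPower`. -/
def powerFactor (h₁ : Fin N → ℂ) : ℝ :=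
  Real.sqrt (S.relayPower h₁ / ((1 - S.θ) * S.Ps / S.d1 ^ S.τ * normSq h₁ + S.N0))

/-- The relay processing matrix `W = ω h₂† h₁† / (‖h₂‖ ‖h₁‖)`, where `h₁` is a column and `h₂` a
row. -/
def relayMatrix (h₁ h₂ : Fin N → ℂ) : Matrix (Fin N) (Fin N) ℂ :=
  ((S.powerFactor h₁ / (fnorm h₂ * fnorm h₁) : ℝ) : ℂ) • Matrix.vecMulVec (star h₂) (star h₁)

/-- The received signal at the destination is `y_d = √(1/d₂^τ) h₂ W y_r + n_d` with
`y_r = √((1-θ) Ps / d₁^τ) h₁ x + n_r`; this is the coefficient of the unit-power message `x`. -/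
def signalGain (h₁ h₂ : Fin N → ℂ) : ℂ :=
  ((Real.sqrt (1 / S.d2 ^ S.τ) * Real.sqrt ((1 - S.θ) * S.Ps / S.d1 ^ S.τ) : ℝ) : ℂ) *
    (h₂ ⬝ᵥ (S.relayMatrix h₁ h₂ *ᵥ h₁))

/-- The row vector `√(1/d₂^τ) h₂ W` by which the relay noise `n_r` reaches the destination. -/
def noiseGain (h₁ h₂ : Fin N → ℂ) : Fin N → ℂ :=
  ((Real.sqrt (1 / S.d2 ^ S.τ) : ℝ) : ℂ) • (h₂ ᵥ* S.relayMatrix h₁ h₂)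

/-- The end-to-end signal-to-noise ratio for given channel vectors; the noises `n_r` and `n_d`
are independent with covariance `N0 I` and variance `N0`. -/
def snr (h₁ h₂ : Fin N → ℂ) : ℝ :=
  ‖S.signalGain h₁ h₂‖ ^ 2 / (S.N0 * normSq (S.noiseGain h₁ h₂) + S.N0)

/-- `γ₁ = ((1-θ) ρ₁ / d₁^τ) ‖h₁‖²`. -/
def gamma1 (h₁ : Fin N → ℂ) : ℝ := (1 - S.θ) * S.rho / S.d1 ^ S.τ * normSq h₁

/-- `γ₂ = (η θ ρ₁ / (d₁^τ d₂^τ)) ‖h₂‖² ‖h₁‖²`. -/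
def gamma2 (h₁ h₂ : Fin N → ℂ) : ℝ :=
  S.η * S.θ * S.rho / (S.d1 ^ S.τ * S.d2 ^ S.τ) * normSq h₂ * normSq h₁

/-- `α = d₁^τ / ((1-θ) ρ₁)`. -/
def alpha : ℝ := S.d1 ^ S.τ / ((1 - S.θ) * S.rho)

/-- `β = d₁^τ d₂^τ / (η θ ρ₁)`. -/
def beta : ℝ := S.d1 ^ S.τ * S.d2 ^ S.τ / (S.η * S.θ * S.rho)

/-- The finite sum of incomplete gamma functions. -/
def closedC1 (N : ℕ) : ℝ :=
  Real.exp S.alpha / (2 * Real.log 2) *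
    ∑ k ∈ Finset.range N, S.alpha ^ k * upperGamma (-(k : ℝ)) S.alpha

/-- The finite sum of Meijer functions `G_{1,3}^{3,1}(β | -m; -m, N-m, 0)`. -/
def closedC2 (N : ℕ) : ℂ :=
  1 / (2 * (Real.log 2 : ℂ)) * (1 / Complex.Gamma (N : ℂ)) *
    ∑ m ∈ Finset.range N, 1 / (m.factorial : ℂ) * (S.beta : ℂ) ^ m *
      meijerG 3 1 ![-(m : ℂ)] ![-(m : ℂ), (N : ℂ) - (m : ℂ), 0] (S.beta : ℂ)

/-- `ψ(N)`: the digamma function `ψ = Γ'/Γ` at the integer `N`. -/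
def psi (N : ℕ) : ℝ := logDeriv Real.Gamma (N : ℝ)

/-- The closed-form capacity bound. -/
def capacityBound (N : ℕ) : ℝ :=
  S.closedC1 N + (S.closedC2 N).re -
    1 / 2 * Real.logb 2 (1 + (1 - S.θ) * S.rho / S.d1 ^ S.τ * Real.exp (psi N) +
      S.η * S.θ * S.rho / (S.d1 ^ S.τ * S.d2 ^ S.τ) * Real.exp (2 * psi N))

end System

/-- The ergodic capacity `(1/2) E[log₂(1 + γ)]` of a link used half of the time with random
signal-to-noise ratio `γ`. -/
def ergodicCapacity {Ω : Type*} [MeasurableSpace Ω] (P : Measure Ω) (γ : Ω → ℝ) : ℝ :=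
  1 / 2 * ∫ ω, Real.logb 2 (1 + γ ω) ∂P

end EHRelay

end

open EHRelay

/-!
Everything is a function of the squared norms `X₁ = ‖h₁‖²` and `X₂ = ‖h₂‖²`. They are independent
with the Gamma law of shape `N` and rate `1` (`hasLaw_normSq_prod`, by characteristic functions),
and `γ₁ = X₁ / α`, `γ₂ = X₁ X₂ / β`.

*The bound.* The matched relay filter gives `γ = γ₁ γ₂ / (1 + γ₁ + γ₂)` (`System.snr_eq`), hence
`1 + γ = (1 + γ₁) (1 + γ₂) / (1 + γ₁ + γ₂)`. The first two factors give `C_γ₁ + C_γ₂`, and Jensen's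
inequality for the convex function `(x, y) ↦ log (1 + e^x + e^y)` at `(ln γ₁, ln γ₂)` bounds the
contribution of the denominator (`integral_log_one_add_harmonic_le`).

*The first link.* Put `J k a = ∫₀^∞ t^k e^(-t) / (a + t) dt` (`gammaStieltjes`). Integration by
parts gives `E log (1 + X / a) = ∑_{k < N} J k a / k!` for a Gamma variable `X`
(`integral_log_one_add_div_gammaMeasure`). On the other hand `J k a = k! a^k e^a Γ(-k, a)`, because
both sides satisfy the same recursion in `k` (`gammaStieltjes_eq_upperGamma`).

*The second link.* Conditioning on `X₂` and using the same formula with `a = β / X₂` gives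
`E log (1 + X₁ X₂ / β) = ∑_{k < N} E [J k (β / X₂)] / k!` (`integral_log_one_add_mul_div`). The
expectation is the double integral over `x, t > 0` of
`x^(N-1) e^(-x) t^(k-1) e^(-t) / (1 + β / (x t))`, divided by `Γ(N)`.
Mellin inversion of `∫₀^∞ x^(s-1) / (1 + x) dx = Γ(s) Γ(1 - s)` writes `1 / (1 + z)` as the integral
of `Γ(-w) Γ(1 + w) z^w` along a vertical line with `-1 < Re w < 0` (`inv_one_add_eq_integral`).
After an interchange of integrals the variables `x` and `t` contribute `Γ(N - w)` and `Γ(k - w)`,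
and `w = s + k` turns the result into the Meijer function (`pow_mul_meijerG_eq`). The interchange is
legitimate since `Γ(-w) Γ(1 + w) = -π / sin (π w)` is integrable along the line.

*The logarithmic means.* `E log X = ψ(N)` is differentiation of Euler's integral under the integral
sign (`integral_log_gammaMeasure`).
-/

namespace EHRelay

/-! ### Jensen's inequality for the log-sum-exp function -/

/-- The convex function `(x, y) ↦ log (1 + e^x + e^y)` lies above its tangent plane at `(a, b)`.
After exponentiation this is weighted AM-GM with the weights `1 / D`, `e^a / D` and `e^b / D`, where
`D = 1 + e^a + e^b`; it follows from `1 + u ≤ e^u` applied to each of the three terms. -/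
theorem log_one_add_exp_add_exp_ge (a b x y : ℝ) :
    Real.log (1 + Real.exp a + Real.exp b) +
      (Real.exp a / (1 + Real.exp a + Real.exp b) * (x - a) +
        Real.exp b / (1 + Real.exp a + Real.exp b) * (y - b)) ≤
      Real.log (1 + Real.exp x + Real.exp y) := by
  set D := 1 + Real.exp a + Real.exp b with hD
  have ha := Real.exp_pos a
  have hb := Real.exp_pos b
  have hDpos : 0 < D := by positivity
  set m := Real.exp a / D * (x - a) + Real.exp b / D * (y - b) with hm
  rw [Real.le_log_iff_exp_le (by positivity), Real.exp_add, Real.exp_log hDpos]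
  have h0 : Real.exp m * (1 - m) ≤ 1 := by
    have := Real.add_one_le_exp (-m)
    calc Real.exp m * (1 - m) ≤ Real.exp m * Real.exp (-m) := by gcongr; linarith
      _ = 1 := by rw [← Real.exp_add]; simp
  have h1 (u v : ℝ) : Real.exp m * (Real.exp u * (1 + (v - u) - m)) ≤ Real.exp v := by
    have := Real.add_one_le_exp (v - u - m)
    calc Real.exp m * (Real.exp u * (1 + (v - u) - m))
        ≤ Real.exp m * (Real.exp u * Real.exp (v - u - m)) := by gcongr; linarith
      _ = Real.exp v := by rw [← Real.exp_add, ← Real.exp_add]; ring_nf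
  have hkey : D * Real.exp m = Real.exp m * (1 - m) +
      Real.exp m * (Real.exp a * (1 + (x - a) - m)) +
      Real.exp m * (Real.exp b * (1 + (y - b) - m)) := by
    have : D * m = Real.exp a * (x - a) + Real.exp b * (y - b) := by
      rw [hm]; field_simp
    linear_combination Real.exp m * this - Real.exp m * (m - 1) * hD
  linarith [h1 a x, h1 b y]

/-- Jensen's inequality for `(x, y) ↦ log (1 + e^x + e^y)`. -/
theorem log_one_add_exp_integral_le {Ω : Type*} [MeasurableSpace Ω] (P : Measure Ω)
    [IsProbabilityMeasure P] {U V : Ω → ℝ} (hU : Integrable U P) (hV : Integrable V P)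
    (hUV : Integrable (fun ω => Real.log (1 + Real.exp (U ω) + Real.exp (V ω))) P) :
    Real.log (1 + Real.exp (∫ ω, U ω ∂P) + Real.exp (∫ ω, V ω ∂P)) ≤
      ∫ ω, Real.log (1 + Real.exp (U ω) + Real.exp (V ω)) ∂P := by
  set a := ∫ ω, U ω ∂P with ha
  set b := ∫ ω, V ω ∂P with hb
  set D := 1 + Real.exp a + Real.exp b
  have hUa : Integrable (fun ω => Real.exp a / D * (U ω - a)) P :=
    (hU.sub (integrable_const a)).const_mul _
  have hVb : Integrable (fun ω => Real.exp b / D * (V ω - b)) P :=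
    (hV.sub (integrable_const b)).const_mul _
  have hmono := integral_mono (μ := P) ((integrable_const (Real.log D)).add (hUa.add hVb)) hUV
    fun ω => log_one_add_exp_add_exp_ge a b (U ω) (V ω)
  have hleft : ∫ ω, (Real.log D + (Real.exp a / D * (U ω - a) +
      Real.exp b / D * (V ω - b))) ∂P = Real.log D := by
    rw [integral_add (integrable_const _) (by exact hUa.add hVb), integral_add hUa hVb,
      integral_const_mul, integral_const_mul, integral_sub hU (integrable_const a),
      integral_sub hV (integrable_const b)]
    simp [← ha, ← hb]
  exact hleft.symm.trans_le hmono

/-! ### The end-to-end signal-to-noise ratio -/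

theorem normSq_nonneg {N : ℕ} (h : Fin N → ℂ) : 0 ≤ normSq h :=
  Finset.sum_nonneg fun _ _ => by positivity

theorem normSq_smul {N : ℕ} (c : ℂ) (h : Fin N → ℂ) : normSq (c • h) = ‖c‖ ^ 2 * normSq h := by
  simp [normSq, mul_pow, Finset.mul_sum]

theorem normSq_star {N : ℕ} (h : Fin N → ℂ) : normSq (star h) = normSq h := by
  simp [normSq]

theorem star_dotProduct_self {N : ℕ} (h : Fin N → ℂ) : star h ⬝ᵥ h = (normSq h : ℂ) := by
  simp [normSq, dotProduct, Complex.conj_mul']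

theorem dotProduct_star_self {N : ℕ} (h : Fin N → ℂ) : h ⬝ᵥ star h = (normSq h : ℂ) := by
  rw [dotProduct_comm, star_dotProduct_self]

theorem fnorm_sq {N : ℕ} (h : Fin N → ℂ) : fnorm h ^ 2 = normSq h :=
  Real.sq_sqrt (normSq_nonneg h)

namespace System

variable (S : System) {N : ℕ}

/-- The matched filters at both ends of the relay reduce the system to a scalar two-hop chain:
`1 / γ = 1 / γ₁ + 1 / γ₂ + 1 / (γ₁ γ₂)`. In the form stated, the identity covers zero channel vectors
too, where both sides vanish. -/
theorem snr_eq (hS : S.Admissible) (h₁ h₂ : Fin N → ℂ) :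
    S.snr h₁ h₂ = S.gamma1 h₁ * S.gamma2 h₁ h₂ / (1 + S.gamma1 h₁ + S.gamma2 h₁ h₂) := by
  obtain ⟨hPs, hN0, hT, hd1, hd2, hη, hθ, hθ1⟩ := hS
  have hθ' : 0 < 1 - S.θ := by linarith
  have hA : 0 < S.d1 ^ S.τ := Real.rpow_pos_of_pos hd1 _
  have hB : 0 < S.d2 ^ S.τ := Real.rpow_pos_of_pos hd2 _
  have hX := normSq_nonneg h₁
  have hY := normSq_nonneg h₂
  set q := S.powerFactor h₁ / (fnorm h₂ * fnorm h₁) with hq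
  have hsig : ‖S.signalGain h₁ h₂‖ ^ 2 = 1 / S.d2 ^ S.τ * ((1 - S.θ) * S.Ps / S.d1 ^ S.τ) *
      (q ^ 2 * normSq h₁ ^ 2 * normSq h₂ ^ 2) := by
    have : S.signalGain h₁ h₂ = ((Real.sqrt (1 / S.d2 ^ S.τ) *
        Real.sqrt ((1 - S.θ) * S.Ps / S.d1 ^ S.τ) * (q * normSq h₁ * normSq h₂) : ℝ) : ℂ) := by
      simp only [signalGain, relayMatrix, Matrix.smul_mulVec, Matrix.vecMulVec_mulVec,
        dotProduct_smul, star_dotProduct_self, ← hq]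
      rw [dotProduct_star_self]
      simp
      ring_nf
      simp
    rw [this, Complex.norm_real, Real.norm_eq_abs, sq_abs, mul_pow, mul_pow, Real.sq_sqrt
      (by positivity), Real.sq_sqrt (by positivity)]
    ring
  have hnoise : normSq (S.noiseGain h₁ h₂) =
      1 / S.d2 ^ S.τ * (q ^ 2 * normSq h₁ * normSq h₂ ^ 2) := by
    have : S.noiseGain h₁ h₂ = ((Real.sqrt (1 / S.d2 ^ S.τ) * (q * normSq h₂) : ℝ) : ℂ) •
        star h₁ := by
      simp only [noiseGain, relayMatrix, Matrix.vecMul_smul, Matrix.vecMul_vecMulVec,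
        dotProduct_star_self, ← hq, smul_smul]
      simp
    rw [this, normSq_smul, normSq_star, Complex.norm_real, Real.norm_eq_abs, sq_abs, mul_pow,
      Real.sq_sqrt (by positivity)]
    ring
  have hpow : S.powerFactor h₁ ^ 2 = S.η * S.θ * S.Ps / S.d1 ^ S.τ * normSq h₁ /
      ((1 - S.θ) * S.Ps / S.d1 ^ S.τ * normSq h₁ + S.N0) := by
    have : S.relayPower h₁ = S.η * S.θ * S.Ps / S.d1 ^ S.τ * normSq h₁ := by
      simp only [relayPower, harvestedEnergy]
      field_simp
    rw [powerFactor, this, Real.sq_sqrt (by positivity)]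
  rw [snr, hsig, hnoise, gamma1, gamma2, rho]
  -- If a channel vanishes, the division by `‖h₁‖ ‖h₂‖` in `W` is by zero, but both sides are `0`.
  rcases hX.eq_or_lt with hX0 | hX0
  · simp [← hX0]
  rcases hY.eq_or_lt with hY0 | hY0
  · simp [← hY0]
  have hq2 : q ^ 2 = S.η * S.θ * S.Ps / S.d1 ^ S.τ /
      ((1 - S.θ) * S.Ps / S.d1 ^ S.τ * normSq h₁ + S.N0) / normSq h₂ := by
    rw [hq, div_pow, mul_pow, fnorm_sq, fnorm_sq, hpow]
    field_simp
  rw [hq2]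
  field_simp
  ring

end System

/-! ### The Gamma law of the squared channel norm -/

theorem integrableOn_pow_mul_exp_neg (n : ℕ) :
    IntegrableOn (fun x : ℝ => x ^ n * Real.exp (-x)) (Set.Ioi 0) := by
  have h := Real.GammaIntegral_convergent (s := (n : ℝ) + 1) (by positivity)
  refine h.congr_fun (fun x _ => ?_) measurableSet_Ioi
  simp [mul_comm]

theorem integral_pow_mul_exp_neg (n : ℕ) :
    ∫ x in Set.Ioi (0 : ℝ), x ^ n * Real.exp (-x) = n.factorial := by
  rw [← Real.Gamma_nat_eq_factorial, Real.Gamma_eq_integral (by positivity)]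
  refine setIntegral_congr_fun measurableSet_Ioi fun x _ => ?_
  simp [mul_comm]

theorem measurable_gammaPDF (a r : ℝ) : Measurable (gammaPDF a r) :=
  (measurable_gammaPDFReal a r).ennreal_ofReal

theorem gammaPDF_natCast_add_one_toReal (n : ℕ) {x : ℝ} (hx : 0 < x) :
    (gammaPDF (n + 1) 1 x).toReal = (n.factorial : ℝ)⁻¹ * (x ^ n * Real.exp (-x)) := by
  rw [gammaPDF_of_nonneg hx.le, ENNReal.toReal_ofReal]
  · simp [Real.Gamma_nat_eq_factorial, mul_assoc]
  · have := Real.Gamma_pos_of_pos (s := (n : ℝ) + 1) (by positivity)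
    positivity

theorem ae_pos_gammaMeasure (n : ℕ) : ∀ᵐ x ∂gammaMeasure (n + 1) 1, 0 < x := by
  rw [gammaMeasure, ae_withDensity_iff (measurable_gammaPDF _ _)]
  have h0 : ∀ᵐ x : ℝ, x ≠ 0 := by simp [ae_iff]
  filter_upwards [h0] with x hx h
  by_contra hneg
  exact h (gammaPDF_of_neg (lt_of_le_of_ne (not_lt.1 hneg) hx))

/-- The Gamma law with integer shape, as a weighted Lebesgue measure on the half-line. -/
theorem gammaMeasure_eq_withDensity_restrict (n : ℕ) :
    gammaMeasure (n + 1) 1 = (volume.restrict (Set.Ioi 0)).withDensity (gammaPDF (n + 1) 1) := by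
  rw [← restrict_withDensity measurableSet_Ioi, ← gammaMeasure]
  exact (Measure.restrict_eq_self_of_ae_mem (ae_pos_gammaMeasure n)).symm

theorem integral_gammaMeasure {E : Type*} [NormedAddCommGroup E] [NormedSpace ℝ E] (n : ℕ)
    (f : ℝ → E) : ∫ x, f x ∂gammaMeasure (n + 1) 1 =
      (n.factorial : ℝ)⁻¹ • ∫ x in Set.Ioi (0 : ℝ), (x ^ n * Real.exp (-x)) • f x := by
  rw [gammaMeasure_eq_withDensity_restrict, integral_withDensity_eq_integral_toReal_smul
    (measurable_gammaPDF _ _) (by simp [gammaPDF]), ← integral_smul]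
  refine setIntegral_congr_fun measurableSet_Ioi fun x hx => ?_
  simp only [gammaPDF_natCast_add_one_toReal n hx, mul_smul]

theorem integrable_gammaMeasure_iff {E : Type*} [NormedAddCommGroup E] [NormedSpace ℝ E] (n : ℕ)
    (f : ℝ → E) : Integrable f (gammaMeasure (n + 1) 1) ↔
      IntegrableOn (fun x : ℝ => (x ^ n * Real.exp (-x)) • f x) (Set.Ioi 0) := by
  rw [gammaMeasure_eq_withDensity_restrict, integrable_withDensity_iff_integrable_smul'
    (measurable_gammaPDF _ _) (by simp [gammaPDF]), IntegrableOn,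
    ← integrable_smul_iff (c := (n.factorial : ℝ)⁻¹) (by positivity)
      (fun x : ℝ => (x ^ n * Real.exp (-x)) • f x)]
  refine integrableOn_congr_fun (fun x hx => ?_) measurableSet_Ioi
  simp only [gammaPDF_natCast_add_one_toReal n hx, mul_smul, Pi.smul_apply]

theorem integrable_id_gammaMeasure (n : ℕ) :
    Integrable (fun x : ℝ => x) (gammaMeasure (n + 1) 1) := by
  rw [integrable_gammaMeasure_iff]
  refine (integrableOn_pow_mul_exp_neg (n + 1)).congr_fun (fun x _ => ?_) measurableSet_Ioi
  simp only [smul_eq_mul]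
  ring

/-- An elementary majorant of `|log x|` that is integrable against the Gamma densities. -/
theorem abs_log_le {x : ℝ} (hx : 0 < x) : |Real.log x| ≤ x + 2 * x ^ (-(1 / 2) : ℝ) := by
  have h1 := Real.log_le_sub_one_of_pos hx
  have hp := Real.rpow_pos_of_pos hx (-(1 / 2) : ℝ)
  have h2 := Real.log_le_sub_one_of_pos hp
  rw [Real.log_rpow hx] at h2
  rw [abs_le]
  constructor <;> linarith

theorem integrable_log_gammaMeasure (n : ℕ) : Integrable Real.log (gammaMeasure (n + 1) 1) := by
  have hg : Integrable (fun x : ℝ => x + 2 * x ^ (-(1 / 2) : ℝ)) (gammaMeasure (n + 1) 1) := by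
    refine (integrable_id_gammaMeasure n).add (Integrable.const_mul ?_ _)
    rw [integrable_gammaMeasure_iff]
    have h := Real.GammaIntegral_convergent (s := (n : ℝ) + 1 / 2) (by positivity)
    refine h.congr_fun (fun x hx => ?_) measurableSet_Ioi
    have : (n : ℝ) + 1 / 2 - 1 = n + -(1 / 2) := by ring
    simp only [smul_eq_mul]
    rw [this, Real.rpow_add hx, Real.rpow_natCast]
    ring
  refine hg.mono Real.measurable_log.aestronglyMeasurable ?_
  filter_upwards [ae_pos_gammaMeasure n] with x hx
  rw [Real.norm_eq_abs, Real.norm_eq_abs]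
  exact (abs_log_le hx).trans (le_abs_self _)

/-- Differentiating Euler's integral under the integral sign. -/
theorem integral_log_gammaMeasure (n : ℕ) :
    ∫ x, Real.log x ∂gammaMeasure (n + 1) 1 = System.psi (n + 1) := by
  set D := ∫ x in Set.Ioi (0 : ℝ), x ^ n * Real.exp (-x) * Real.log x with hD
  have hs : 0 < (((n + 1 : ℕ) : ℝ) : ℂ).re := by simp; positivity
  have h := Complex.hasDerivAt_GammaIntegral hs
  have hval : ∫ t : ℝ in Set.Ioi 0, (t : ℂ) ^ ((((n + 1 : ℕ) : ℝ) : ℂ) - 1) *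
      (Real.log t * Real.exp (-t)) = (D : ℂ) := by
    rw [hD, ← integral_complex_ofReal]
    refine setIntegral_congr_fun measurableSet_Ioi fun x _ => ?_
    simp
    ring
  rw [hval] at h
  have hG : HasDerivAt Complex.Gamma (D : ℂ) (((n + 1 : ℕ) : ℝ) : ℂ) := by
    refine h.congr_of_eventuallyEq ?_
    filter_upwards [(Complex.continuous_re.isOpen_preimage _ isOpen_Ioi).mem_nhds hs] with z hz
    exact Complex.Gamma_eq_integral hz
  have hR : HasDerivAt Real.Gamma D ((n + 1 : ℕ) : ℝ) := hG.real_of_complex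
  rw [integral_gammaMeasure, System.psi, logDeriv_apply, hR.deriv]
  simp [Real.Gamma_nat_eq_factorial, hD, div_eq_inv_mul]

/-- Euler's integral with a complex rate on the line `Re r = 1`, by induction on the exponent. -/
theorem integral_pow_mul_cexp_neg_mul (n : ℕ) {r : ℂ} (hr : r.re = 1) :
    ∫ x in Set.Ioi (0 : ℝ), ((x ^ n : ℝ) : ℂ) * Complex.exp (-r * x) =
      n.factorial / r ^ (n + 1) := by
  have hr0 : r ≠ 0 := by rintro rfl; simp at hr
  have hnorm (k : ℕ) (x : ℝ) (hx : 0 ≤ x) :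
      ‖((x ^ k : ℝ) : ℂ) * Complex.exp (-r * x)‖ = x ^ k * Real.exp (-x) := by
    rw [norm_mul, Complex.norm_real, Complex.norm_exp, Real.norm_of_nonneg (by positivity)]
    simp [hr]
  have hint (k : ℕ) : IntegrableOn (fun x : ℝ => ((x ^ k : ℝ) : ℂ) * Complex.exp (-r * x))
      (Set.Ioi 0) := by
    refine (integrableOn_pow_mul_exp_neg k).mono' (by fun_prop) ?_
    filter_upwards [ae_restrict_mem measurableSet_Ioi] with x hx
    exact (hnorm k x (Set.mem_Ioi.1 hx).le).le
  induction n with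
  | zero =>
    have := integral_exp_mul_complex_Ioi (a := -r) (by simp [hr]) 0
    simpa using this
  | succ n ih =>
    have hu : ∀ x ∈ Set.Ioi (0 : ℝ), HasDerivAt (fun x : ℝ => ((x ^ (n + 1) : ℝ) : ℂ))
        ((n + 1 : ℂ) * ((x ^ n : ℝ) : ℂ)) x := fun x _ => by
      have := (hasDerivAt_pow (n + 1) x).ofReal_comp
      simpa using this
    have hv : ∀ x ∈ Set.Ioi (0 : ℝ), HasDerivAt (fun x : ℝ => -r⁻¹ * Complex.exp (-r * x))
        (Complex.exp (-r * x)) x := fun x _ => by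
      have := ((((hasDerivAt_id (x : ℂ)).const_mul (-r)).cexp).const_mul (-r⁻¹)).comp_ofReal
      convert! this using 1
      simp
      field_simp
    have hlim0 : Filter.Tendsto ((fun x : ℝ => ((x ^ (n + 1) : ℝ) : ℂ)) *
        fun x : ℝ => -r⁻¹ * Complex.exp (-r * x)) (nhdsWithin 0 (Set.Ioi 0)) (nhds 0) := by
      have : Continuous ((fun x : ℝ => ((x ^ (n + 1) : ℝ) : ℂ)) *
        fun x : ℝ => -r⁻¹ * Complex.exp (-r * x)) := by fun_prop
      simpa using (this.tendsto 0).mono_left nhdsWithin_le_nhds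
    have hliminf : Filter.Tendsto ((fun x : ℝ => ((x ^ (n + 1) : ℝ) : ℂ)) *
        fun x : ℝ => -r⁻¹ * Complex.exp (-r * x)) Filter.atTop (nhds 0) := by
      rw [tendsto_zero_iff_norm_tendsto_zero]
      have h := (Real.tendsto_pow_mul_exp_neg_atTop_nhds_zero (n + 1)).const_mul ‖r⁻¹‖
      rw [mul_zero] at h
      refine h.congr' ?_
      filter_upwards [Filter.eventually_ge_atTop 0] with x hx
      rw [Pi.mul_apply, ← hnorm _ x hx]
      simp
      ring
    have := integral_Ioi_mul_deriv_eq_deriv_mul hu hv (hint (n + 1))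
      (IntegrableOn.congr_fun ((hint n).const_mul (-(n + 1 : ℂ) * r⁻¹))
        (fun x _ => by simp only [Pi.mul_apply]; ring) measurableSet_Ioi) hlim0 hliminf
    rw [this]
    have hcongr : ∀ x : ℝ, (n + 1 : ℂ) * ((x ^ n : ℝ) : ℂ) * (-r⁻¹ * Complex.exp (-r * x)) =
        -(n + 1 : ℂ) * r⁻¹ * (((x ^ n : ℝ) : ℂ) * Complex.exp (-r * x)) := fun x => by ring
    simp_rw [hcongr]
    rw [integral_const_mul, ih, Nat.factorial_succ]
    push_cast
    field_simp
    ring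

theorem charFun_gammaMeasure (n : ℕ) (t : ℝ) :
    charFun (gammaMeasure (n + 1) 1) t = (1 - t * Complex.I)⁻¹ ^ (n + 1) := by
  rw [charFun_apply_real, integral_gammaMeasure]
  have h := integral_pow_mul_cexp_neg_mul n (r := 1 - t * Complex.I) (by simp)
  have hcongr : ∀ x : ℝ, (x ^ n * Real.exp (-x)) • Complex.exp (t * x * Complex.I) =
      ((x ^ n : ℝ) : ℂ) * Complex.exp (-(1 - t * Complex.I) * x) := fun x => by
    rw [Complex.real_smul, Complex.ofReal_mul, Complex.ofReal_exp, mul_assoc, ← Complex.exp_add]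
    congr 2
    push_cast
    ring
  simp_rw [hcongr]
  rw [h, Complex.real_smul]
  have : (n.factorial : ℂ) ≠ 0 := by exact_mod_cast n.factorial_ne_zero
  rw [inv_pow]
  push_cast
  field_simp

/-- The characteristic function of `|h|²` for `h ∼ CN(0,1)`, as the square of a complex Gaussian
integral. -/
theorem integral_cexp_normSq_complexNormal (t : ℝ) :
    ∫ z, Complex.exp (t * (‖z‖ ^ 2 : ℝ) * Complex.I) ∂complexNormal =
      (1 - t * Complex.I)⁻¹ := by
  have hmeas : Measurable fun p : ℝ × ℝ => Complex.mk p.1 p.2 :=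
    Complex.measurableEquivRealProd.symm.measurable
  have hone : ∫ x, Complex.exp (t * (x ^ 2 : ℝ) * Complex.I) ∂gaussianReal 0 (1 / 2) =
      ((Real.sqrt Real.pi)⁻¹ : ℝ) *
        ∫ x : ℝ, Complex.exp (-(1 - t * Complex.I) * (x : ℂ) ^ 2) := by
    rw [integral_gaussianReal_eq_integral_smul (by norm_num), ← integral_const_mul]
    congr 1
    ext x
    rw [gaussianPDFReal, Complex.real_smul, Complex.ofReal_mul, mul_assoc, Complex.ofReal_exp,
      ← Complex.exp_add]
    have hv : (((1 / 2 : NNReal) : ℝ) : ℂ) = 1 / 2 := by norm_num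
    have hvar : 2 * Real.pi * ((1 / 2 : NNReal) : ℝ) = Real.pi := by
      push_cast
      ring
    rw [hvar]
    congr 1
    · congr 1
      push_cast [hv]
      ring
  rw [complexNormal, integral_map hmeas.aemeasurable (by fun_prop)]
  have hsplit : ∀ p : ℝ × ℝ, Complex.exp (t * (‖Complex.mk p.1 p.2‖ ^ 2 : ℝ) * Complex.I) =
      Complex.exp (t * (p.1 ^ 2 : ℝ) * Complex.I) * Complex.exp (t * (p.2 ^ 2 : ℝ) * Complex.I) :=
    fun p => by
      rw [← Complex.exp_add, ← Complex.normSq_eq_norm_sq, Complex.normSq_mk]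
      push_cast
      ring_nf
  simp_rw [hsplit]
  rw [integral_prod_mul (fun x : ℝ => Complex.exp (t * (x ^ 2 : ℝ) * Complex.I))
    (fun x : ℝ => Complex.exp (t * (x ^ 2 : ℝ) * Complex.I)), hone]
  have hsq := integral_gaussian_sq_complex (b := 1 - t * Complex.I) (by simp)
  have hpi : ((Real.sqrt Real.pi)⁻¹ : ℝ) ^ 2 = Real.pi⁻¹ := by
    rw [inv_pow, Real.sq_sqrt Real.pi_pos.le]
  rw [mul_mul_mul_comm, ← sq, ← sq, hsq, ← Complex.ofReal_pow, hpi]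
  have : (Real.pi : ℂ) ≠ 0 := by exact_mod_cast Real.pi_ne_zero
  push_cast
  field_simp

theorem measurable_normSq {N : ℕ} : Measurable (normSq : (Fin N → ℂ) → ℝ) := by
  unfold normSq
  fun_prop

/-- The squared norm of a vector of `n + 1` i.i.d. `CN(0,1)` entries is Gamma distributed with
shape `n + 1`. -/
theorem hasLaw_normSq {Ω : Type*} [MeasurableSpace Ω] {P : Measure Ω} [IsProbabilityMeasure P]
    {n : ℕ} {h : Fin (n + 1) → Ω → ℂ} (hlaw : ∀ i, HasLaw (h i) complexNormal P)
    (hindep : iIndepFun h P) :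
    HasLaw (fun ω => normSq fun i => h i ω) (gammaMeasure (n + 1) 1) P := by
  have hae : AEMeasurable (fun ω => normSq fun i => h i ω) P :=
    measurable_normSq.comp_aemeasurable (aemeasurable_pi_lambda _ fun i => (hlaw i).aemeasurable)
  refine ⟨hae, ?_⟩
  have := isProbabilityMeasure_gammaMeasure (a := n + 1) (r := 1) (by positivity) one_pos
  have : IsProbabilityMeasure (P.map fun ω => normSq fun i => h i ω) :=
    Measure.isProbabilityMeasure_map hae
  refine Measure.ext_of_charFun (funext fun t => ?_)
  rw [charFun_gammaMeasure, charFun_apply_real, integral_map hae (by fun_prop)]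
  have hprod : ∀ ω, Complex.exp (t * (normSq fun i => h i ω : ℝ) * Complex.I) =
      ∏ i, (fun z : ℂ => Complex.exp (t * (‖z‖ ^ 2 : ℝ) * Complex.I)) (h i ω) := fun ω => by
    rw [← Complex.exp_sum, normSq]
    push_cast
    rw [Finset.mul_sum, Finset.sum_mul]
  simp_rw [hprod]
  rw [hindep.integral_fun_prod_comp (f := fun _ z => Complex.exp (t * (‖z‖ ^ 2 : ℝ) * Complex.I))
    (fun i => (hlaw i).aemeasurable) (fun i => by fun_prop)]
  have heach : ∀ i, ∫ ω, Complex.exp (t * (‖h i ω‖ ^ 2 : ℝ) * Complex.I) ∂P =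
      (1 - t * Complex.I)⁻¹ := fun i => by
    rw [← integral_cexp_normSq_complexNormal]
    exact (hlaw i).integral_comp (f := fun z => Complex.exp (t * (‖z‖ ^ 2 : ℝ) * Complex.I))
      (by fun_prop)
  simp_rw [heach]
  simp

/-- The two squared channel norms are independent Gamma variables. -/
theorem hasLaw_normSq_prod {Ω : Type*} [MeasurableSpace Ω] {P : Measure Ω}
    [IsProbabilityMeasure P] {n : ℕ} {h₁ h₂ : Fin (n + 1) → Ω → ℂ}
    (hlaw₁ : ∀ i, HasLaw (h₁ i) complexNormal P) (hlaw₂ : ∀ i, HasLaw (h₂ i) complexNormal P)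
    (hindep : iIndepFun (Sum.elim h₁ h₂ : Fin (n + 1) ⊕ Fin (n + 1) → Ω → ℂ) P) :
    HasLaw (fun ω => (normSq fun i => h₁ i ω, normSq fun i => h₂ i ω))
      ((gammaMeasure (n + 1) 1).prod (gammaMeasure (n + 1) 1)) P := by
  have hmeas : ∀ i, AEMeasurable ((Sum.elim h₁ h₂ : Fin (n + 1) ⊕ Fin (n + 1) → Ω → ℂ) i) P := by
    rintro (i | i)
    · exact (hlaw₁ i).aemeasurable
    · exact (hlaw₂ i).aemeasurable
  have hi₁ : iIndepFun h₁ P := iIndepFun.precomp (f := Sum.elim h₁ h₂) Sum.inl_injective hindep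
  have hi₂ : iIndepFun h₂ P := iIndepFun.precomp (f := Sum.elim h₁ h₂) Sum.inr_injective hindep
  have := isProbabilityMeasure_gammaMeasure (a := n + 1) (r := 1) (by positivity) one_pos
  refine IndepFun.hasLaw_prod (hasLaw_normSq hlaw₁ hi₁) (hasLaw_normSq hlaw₂ hi₂) ?_
  set A : Finset (Fin (n + 1) ⊕ Fin (n + 1)) := Finset.univ.map Function.Embedding.inl
  set B : Finset (Fin (n + 1) ⊕ Fin (n + 1)) := Finset.univ.map Function.Embedding.inr
  have hAB : Disjoint A B := by
    simp [A, B, Finset.disjoint_left]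
  have h := hindep.indepFun_finset₀ A B hAB hmeas
  exact h.comp (φ := fun v : A → ℂ => normSq fun i => v ⟨Sum.inl i, by simp [A]⟩)
    (ψ := fun v : B → ℂ => normSq fun i => v ⟨Sum.inr i, by simp [B]⟩)
    (measurable_normSq.comp (by fun_prop)) (measurable_normSq.comp (by fun_prop))

/-! ### Logarithmic moments and the incomplete gamma function -/

/-- The Stieltjes transform `∫₀^∞ t^k e^(-t) / (a + t) dt` of the unnormalized Gamma density of
shape `k + 1`. -/
noncomputable def gammaStieltjes (k : ℕ) (a : ℝ) : ℝ :=
  ∫ t in Set.Ioi (0 : ℝ), t ^ k * Real.exp (-t) / (a + t)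

theorem integrableOn_gammaStieltjes (k : ℕ) {a : ℝ} (ha : 0 < a) :
    IntegrableOn (fun t : ℝ => t ^ k * Real.exp (-t) / (a + t)) (Set.Ioi 0) := by
  refine ((integrableOn_pow_mul_exp_neg k).div_const a).mono'
    (Measurable.aestronglyMeasurable (by fun_prop)) ?_
  filter_upwards [ae_restrict_mem measurableSet_Ioi] with t ht
  have ht : 0 < t := ht
  rw [Real.norm_of_nonneg (by positivity)]
  gcongr
  linarith

theorem gammaStieltjes_succ (k : ℕ) {a : ℝ} (ha : 0 < a) :
    gammaStieltjes (k + 1) a = k.factorial - a * gammaStieltjes k a := by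
  rw [gammaStieltjes, gammaStieltjes, ← integral_pow_mul_exp_neg, ← integral_const_mul,
    ← integral_sub (integrableOn_pow_mul_exp_neg k)
      ((integrableOn_gammaStieltjes k ha).const_mul a)]
  refine setIntegral_congr_fun measurableSet_Ioi fun t ht => ?_
  have ht : 0 < t := ht
  field_simp
  ring

theorem integrableOn_upperGamma (s : ℝ) {x : ℝ} (hx : 0 < x) :
    IntegrableOn (fun t : ℝ => t ^ (s - 1) * Real.exp (-t)) (Set.Ioi x) := by
  refine integrable_of_isBigO_exp_neg (b := 1 / 2) (by norm_num) ?_ ?_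
  · refine ContinuousOn.mul (fun t ht => ?_) (by fun_prop)
    exact (Real.continuousAt_rpow_const _ _ (Or.inl (hx.trans_le ht).ne')).continuousWithinAt
  · simpa [mul_comm] using (Real.Gamma_integrand_isLittleO (s - 1)).isBigO

/-- The recursion of the incomplete gamma function, valid at every real order. -/
theorem upperGamma_add_one (s : ℝ) {x : ℝ} (hx : 0 < x) :
    upperGamma (s + 1) x = s * upperGamma s x + x ^ s * Real.exp (-x) := by
  have hu : ∀ t ∈ Set.Ioi x, HasDerivAt (fun t : ℝ => t ^ s) (s * t ^ (s - 1)) t := fun t ht =>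
    Real.hasDerivAt_rpow_const (Or.inl (hx.trans ht).ne')
  have hv : ∀ t ∈ Set.Ioi x, HasDerivAt (fun t : ℝ => -Real.exp (-t)) (Real.exp (-t)) t :=
    fun t _ => by
      convert! (hasDerivAt_neg t).exp.neg using 1
      ring
  have hlim : Filter.Tendsto ((fun t : ℝ => t ^ s) * fun t => -Real.exp (-t))
      (nhdsWithin x (Set.Ioi x)) (nhds (x ^ s * -Real.exp (-x))) := by
    refine Filter.Tendsto.mono_left ?_ nhdsWithin_le_nhds
    have h1 : ContinuousAt (fun t : ℝ => t ^ s) x :=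
      Real.continuousAt_rpow_const _ _ (Or.inl hx.ne')
    have h2 : ContinuousAt (fun t : ℝ => -Real.exp (-t)) x := by fun_prop
    exact h1.mul h2
  have hinf : Filter.Tendsto ((fun t : ℝ => t ^ s) * fun t => -Real.exp (-t)) Filter.atTop
      (nhds 0) := by
    have := (tendsto_rpow_mul_exp_neg_mul_atTop_nhds_zero s 1 one_pos).neg
    simpa [Pi.mul_def] using this
  have h := integral_Ioi_mul_deriv_eq_deriv_mul hu hv
    (by simpa [Pi.mul_def] using integrableOn_upperGamma (s + 1) hx)
    (IntegrableOn.congr_fun ((integrableOn_upperGamma s hx).const_mul (-s))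
      (fun t _ => by simp only [Pi.mul_apply]; ring) measurableSet_Ioi) hlim hinf
  have hcongr : ∀ t : ℝ, s * t ^ (s - 1) * -Real.exp (-t) =
      -s * (t ^ (s - 1) * Real.exp (-t)) := fun t => by ring
  simp_rw [hcongr] at h
  rw [integral_const_mul] at h
  rw [upperGamma, upperGamma, add_sub_cancel_right, h]
  ring

theorem gammaStieltjes_zero (a : ℝ) : gammaStieltjes 0 a = Real.exp a * upperGamma 0 a := by
  rw [upperGamma, gammaStieltjes, ← integral_const_mul]
  have h := (measurePreserving_add_left volume a).setIntegral_preimage_emb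
    (MeasurableEquiv.addLeft a).measurableEmbedding
    (fun t : ℝ => Real.exp a * (t ^ ((0 : ℝ) - 1) * Real.exp (-t))) (Set.Ioi a)
  rw [← h]
  simp only [Set.preimage_const_add_Ioi, sub_self]
  refine setIntegral_congr_fun measurableSet_Ioi fun t _ => ?_
  have : Real.exp (-(a + t)) = Real.exp (-t) / Real.exp a := by
    rw [← Real.exp_sub]
    ring_nf
  simp only [this, zero_sub, Real.rpow_neg_one]
  field_simp

/-- Both sides satisfy the recursion `J (k + 1) = k! - a J k`. -/
theorem gammaStieltjes_eq_upperGamma (k : ℕ) {a : ℝ} (ha : 0 < a) :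
    gammaStieltjes k a = k.factorial * (Real.exp a * (a ^ k * upperGamma (-k) a)) := by
  induction k with
  | zero => simp [gammaStieltjes_zero]
  | succ k ih =>
    have h := upperGamma_add_one (-((k + 1 : ℕ) : ℝ)) ha
    have hk : -((k + 1 : ℕ) : ℝ) + 1 = -k := by push_cast; ring
    rw [hk, Real.rpow_neg ha.le, Real.rpow_natCast] at h
    have hexp : Real.exp (-a) = (Real.exp a)⁻¹ := Real.exp_neg a
    rw [gammaStieltjes_succ k ha, ih, h, hexp, Nat.factorial_succ]
    push_cast
    field_simp
    ring

theorem log_one_add_div_le {a x : ℝ} (ha : 0 < a) (hx : 0 ≤ x) :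
    Real.log (1 + x / a) ≤ x / a := by
  have := Real.log_le_sub_one_of_pos (x := 1 + x / a) (by positivity)
  linarith

theorem integrableOn_pow_mul_exp_neg_mul_log (n : ℕ) {a : ℝ} (ha : 0 < a) :
    IntegrableOn (fun x : ℝ => x ^ n * Real.exp (-x) * Real.log (1 + x / a)) (Set.Ioi 0) := by
  refine ((integrableOn_pow_mul_exp_neg (n + 1)).div_const a).mono'
    (Measurable.aestronglyMeasurable (by fun_prop)) ?_
  filter_upwards [ae_restrict_mem measurableSet_Ioi] with x hx
  have hx : 0 < x := hx
  have h0 : 0 ≤ Real.log (1 + x / a) := Real.log_nonneg (by linarith [div_pos hx ha])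
  rw [Real.norm_of_nonneg (by positivity)]
  calc x ^ n * Real.exp (-x) * Real.log (1 + x / a) ≤ x ^ n * Real.exp (-x) * (x / a) := by
        gcongr
        exact log_one_add_div_le ha hx.le
    _ = x ^ (n + 1) * Real.exp (-x) / a := by ring

/-- Integration by parts of `log (1 + x / a)` against the derivative of `-x^n e^(-x)`. For `n = 0`
the truncated exponent `n - 1` does no harm, as its term carries the factor `n`. -/
theorem integral_pow_mul_exp_neg_mul_log_sub (n : ℕ) {a : ℝ} (ha : 0 < a) :
    (∫ x in Set.Ioi (0 : ℝ), x ^ n * Real.exp (-x) * Real.log (1 + x / a)) -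
      n * ∫ x in Set.Ioi (0 : ℝ), x ^ (n - 1) * Real.exp (-x) * Real.log (1 + x / a) =
    gammaStieltjes n a := by
  have hu : ∀ x ∈ Set.Ioi (0 : ℝ), HasDerivAt (fun x : ℝ => Real.log (1 + x / a))
      (1 / (a + x)) x := fun x hx => by
    have hx : 0 < x := hx
    have := (((hasDerivAt_id x).div_const a).const_add 1).log (by simp; positivity)
    convert! this using 1
    simp
    field_simp
  have hv : ∀ x ∈ Set.Ioi (0 : ℝ), HasDerivAt (fun x : ℝ => -(x ^ n * Real.exp (-x)))
      (x ^ n * Real.exp (-x) - n * (x ^ (n - 1) * Real.exp (-x))) x := fun x _ => by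
    have := ((hasDerivAt_pow n x).mul (hasDerivAt_neg x).exp).neg
    convert! this using 1
    ring
  have hlim : Filter.Tendsto ((fun x : ℝ => Real.log (1 + x / a)) *
      fun x => -(x ^ n * Real.exp (-x))) (nhdsWithin 0 (Set.Ioi 0)) (nhds 0) := by
    refine Filter.Tendsto.mono_left ?_ nhdsWithin_le_nhds
    have : ContinuousAt ((fun x : ℝ => Real.log (1 + x / a)) *
      fun x => -(x ^ n * Real.exp (-x))) 0 := by
      refine ContinuousAt.mul (ContinuousAt.log (by fun_prop) (by simp)) (by fun_prop)
    simpa [ContinuousAt] using this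
  have hinf : Filter.Tendsto ((fun x : ℝ => Real.log (1 + x / a)) *
      fun x => -(x ^ n * Real.exp (-x))) Filter.atTop (nhds 0) := by
    have h := ((Real.tendsto_pow_mul_exp_neg_atTop_nhds_zero (n + 1)).div_const a).neg
    rw [zero_div, neg_zero] at h
    refine tendsto_of_tendsto_of_tendsto_of_le_of_le' h tendsto_const_nhds ?_ ?_
    all_goals
      filter_upwards [Filter.eventually_gt_atTop 0] with x hx
      have h0 : 0 ≤ Real.log (1 + x / a) := Real.log_nonneg (by linarith [div_pos hx ha])
      have h1 := log_one_add_div_le ha hx.le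
      have h2 : 0 ≤ x ^ n * Real.exp (-x) := by positivity
      simp only [Pi.mul_apply]
    · have := mul_le_mul_of_nonneg_right h1 h2
      have h3 : x / a * (x ^ n * Real.exp (-x)) = x ^ (n + 1) * Real.exp (-x) / a := by ring
      linarith
    · nlinarith
  have hi := integrableOn_pow_mul_exp_neg_mul_log n ha
  have hi' := (integrableOn_pow_mul_exp_neg_mul_log (n - 1) ha).const_mul (n : ℝ)
  have h := integral_Ioi_mul_deriv_eq_deriv_mul hu hv
    (IntegrableOn.congr_fun (hi.sub hi') (fun x _ => by simp only [Pi.mul_apply, Pi.sub_apply]; ring)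
      measurableSet_Ioi)
    (IntegrableOn.congr_fun (integrableOn_gammaStieltjes n ha).neg
      (fun x _ => by simp only [Pi.mul_apply, Pi.neg_apply]; ring) measurableSet_Ioi) hlim hinf
  rw [← integral_const_mul, ← integral_sub hi hi', gammaStieltjes]
  calc _ = ∫ x in Set.Ioi (0 : ℝ), Real.log (1 + x / a) *
        (x ^ n * Real.exp (-x) - n * (x ^ (n - 1) * Real.exp (-x))) := by
        congr 1
        ext x
        ring
    _ = -∫ x in Set.Ioi (0 : ℝ), 1 / (a + x) * -(x ^ n * Real.exp (-x)) := by rw [h]; simp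
    _ = _ := by
        rw [← integral_neg]
        congr 1
        ext x
        ring

theorem integral_pow_mul_exp_neg_mul_log (n : ℕ) {a : ℝ} (ha : 0 < a) :
    ∫ x in Set.Ioi (0 : ℝ), x ^ n * Real.exp (-x) * Real.log (1 + x / a) =
      n.factorial * ∑ k ∈ Finset.range (n + 1), (k.factorial : ℝ)⁻¹ * gammaStieltjes k a := by
  induction n with
  | zero => simpa using integral_pow_mul_exp_neg_mul_log_sub 0 ha
  | succ n ih =>
    have h := integral_pow_mul_exp_neg_mul_log_sub (n + 1) ha
    rw [Nat.add_sub_cancel, ih, sub_eq_iff_eq_add] at h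
    rw [h, Finset.sum_range_succ _ (n + 1), Nat.factorial_succ]
    have := n.factorial_ne_zero
    push_cast
    field_simp
    ring

theorem integrable_log_one_add_div_gammaMeasure (n : ℕ) {a : ℝ} (ha : 0 < a) :
    Integrable (fun x => Real.log (1 + x / a)) (gammaMeasure (n + 1) 1) := by
  rw [integrable_gammaMeasure_iff]
  exact integrableOn_pow_mul_exp_neg_mul_log n ha

theorem integral_log_one_add_div_gammaMeasure (n : ℕ) {a : ℝ} (ha : 0 < a) :
    ∫ x, Real.log (1 + x / a) ∂gammaMeasure (n + 1) 1 =
      ∑ k ∈ Finset.range (n + 1), (k.factorial : ℝ)⁻¹ * gammaStieltjes k a := by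
  rw [integral_gammaMeasure]
  simp only [smul_eq_mul]
  rw [integral_pow_mul_exp_neg_mul_log n ha, inv_mul_cancel_left₀]
  exact_mod_cast n.factorial_ne_zero

/-! ### The Mellin-Barnes integral of `1 / (1 + z)` -/

/-- On a vertical line `Γ(s) Γ(1 - s) = π / sin (π s)` decays at least quadratically:
`|sin (π (σ + i y))| ≥ sin (π σ) cosh (π y)`, and `cosh (π y) ≥ (1 + y²) / 4`. -/
theorem norm_Gamma_mul_Gamma_one_sub_le {σ : ℝ} (h0 : 0 < σ) (h1 : σ < 1) (y : ℝ) :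
    ‖Complex.Gamma (σ + y * Complex.I) * Complex.Gamma (1 - (σ + y * Complex.I))‖ ≤
      4 * Real.pi / Real.sin (Real.pi * σ) * (1 + y ^ 2)⁻¹ := by
  have hsin : 0 < Real.sin (Real.pi * σ) :=
    Real.sin_pos_of_pos_of_lt_pi (by positivity) (by nlinarith [Real.pi_pos])
  have hcosh : (1 + y ^ 2) / 4 ≤ Real.cosh (Real.pi * y) := by
    have hq := Real.quadratic_le_exp_of_nonneg (abs_nonneg (Real.pi * y))
    have hpi : 1 ≤ Real.pi ^ 2 := by nlinarith [Real.pi_gt_three]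
    have habs : y ^ 2 ≤ |Real.pi * y| ^ 2 := by
      rw [sq_abs, mul_pow]
      nlinarith [sq_nonneg y]
    rw [← Real.cosh_abs, Real.cosh_eq]
    linarith [Real.exp_pos (-|Real.pi * y|), abs_nonneg (Real.pi * y)]
  have hre : Real.sin (Real.pi * σ) * Real.cosh (Real.pi * y) ≤
      ‖Complex.sin (Real.pi * (σ + y * Complex.I))‖ := by
    refine le_trans (le_of_eq ?_) (Complex.re_le_norm _)
    have : (Real.pi : ℂ) * (σ + y * Complex.I) =
        ((Real.pi * σ : ℝ) : ℂ) + ((Real.pi * y : ℝ) : ℂ) * Complex.I := by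
      push_cast
      ring
    rw [this, Complex.sin_add_mul_I, ← Complex.ofReal_sin, ← Complex.ofReal_cosh,
      ← Complex.ofReal_cos, ← Complex.ofReal_sinh, Complex.add_re, Complex.mul_I_re,
      ← Complex.ofReal_mul, ← Complex.ofReal_mul, Complex.ofReal_re, Complex.ofReal_im]
    ring
  rw [Complex.Gamma_mul_Gamma_one_sub, norm_div, Complex.norm_real,
    Real.norm_of_nonneg Real.pi_pos.le]
  have hy : 0 < 1 + y ^ 2 := by positivity
  calc Real.pi / ‖Complex.sin (Real.pi * (σ + y * Complex.I))‖
      ≤ Real.pi / (Real.sin (Real.pi * σ) * ((1 + y ^ 2) / 4)) := by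
        gcongr
        exact (mul_le_mul_of_nonneg_left hcosh hsin.le).trans hre
    _ = _ := by field_simp

theorem integrable_Gamma_mul_Gamma_one_sub {σ : ℝ} (h0 : 0 < σ) (h1 : σ < 1) :
    Integrable fun y : ℝ => Complex.Gamma (σ + y * Complex.I) *
      Complex.Gamma (1 - (σ + y * Complex.I)) := by
  refine (integrable_inv_one_add_sq.const_mul (4 * Real.pi / Real.sin (Real.pi * σ))).mono' ?_
    (Filter.Eventually.of_forall fun y => norm_Gamma_mul_Gamma_one_sub_le h0 h1 y)
  simp_rw [Complex.Gamma_mul_Gamma_one_sub]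
  exact Measurable.aestronglyMeasurable (by fun_prop)

/-- The double integral behind `∫ x ^ (s - 1) / (1 + x) dx = Γ(s) Γ(1 - s)`, obtained from
`1 / (1 + x) = ∫ exp (-u (1 + x)) du`, converges absolutely. -/
theorem integrable_cpow_mul_exp_prod {s : ℂ} (h0 : 0 < s.re) (h1 : s.re < 1) :
    Integrable (fun p : ℝ × ℝ =>
      (p.1 : ℂ) ^ (s - 1) * Complex.exp (-(p.2 * p.1)) * Complex.exp (-p.2))
      ((volume.restrict (Set.Ioi (0 : ℝ))).prod (volume.restrict (Set.Ioi (0 : ℝ)))) := by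
  have hFm : Measurable (fun p : ℝ × ℝ =>
      (p.1 : ℂ) ^ (s - 1) * Complex.exp (-(p.2 * p.1)) * Complex.exp (-p.2)) := by
    fun_prop
  have hnorm : ∀ x u : ℝ, 0 < x →
      ‖(x : ℂ) ^ (s - 1) * Complex.exp (-(u * x)) * Complex.exp (-u)‖ =
        x ^ (s.re - 1) * Real.exp (-(u * x)) * Real.exp (-u) := fun x u hx => by
    simp only [norm_mul, Complex.norm_cpow_eq_rpow_re_of_pos hx, Complex.norm_exp]
    simp
  rw [integrable_prod_iff' hFm.aestronglyMeasurable]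
  constructor
  · filter_upwards [ae_restrict_mem measurableSet_Ioi] with u hu
    have hre : IntegrableOn (fun x : ℝ => x ^ (s.re - 1) * Real.exp (-(u * x))) (Set.Ioi 0) := by
      simpa using integrableOn_rpow_mul_exp_neg_mul_rpow (s := s.re - 1) (by linarith) one_pos hu
    refine Integrable.mono' (Integrable.mul_const hre (Real.exp (-u)))
      (Measurable.aestronglyMeasurable (by fun_prop)) ?_
    filter_upwards [ae_restrict_mem measurableSet_Ioi] with x hx
    exact (hnorm x u hx).le
  · have hG := (Real.GammaIntegral_convergent (s := 1 - s.re) (by linarith)).mul_const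
      (Real.Gamma s.re)
    refine Integrable.congr hG ?_
    filter_upwards [ae_restrict_mem measurableSet_Ioi] with u hu
    have hu : 0 < u := hu
    rw [setIntegral_congr_fun measurableSet_Ioi fun x hx => hnorm x u hx,
      integral_mul_const, Real.integral_rpow_mul_exp_neg_mul_Ioi h0 hu, one_div,
      Real.inv_rpow hu.le, ← Real.rpow_neg hu.le]
    have : 1 - s.re - 1 = -s.re := by ring
    rw [this]
    ring

theorem integral_cpow_mul_exp_right (s : ℂ) {x : ℝ} (hx : 0 < x) :
    ∫ u in Set.Ioi (0 : ℝ), (x : ℂ) ^ (s - 1) * Complex.exp (-(u * x)) * Complex.exp (-u) =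
      (x : ℂ) ^ (s - 1) * (1 + (x : ℂ))⁻¹ := by
  have h := integral_exp_mul_complex_Ioi (a := -(1 + (x : ℂ))) (by simp; linarith) 0
  have hcongr : ∀ u : ℝ, (x : ℂ) ^ (s - 1) * Complex.exp (-(u * x)) * Complex.exp (-u) =
      (x : ℂ) ^ (s - 1) * Complex.exp (-(1 + (x : ℂ)) * u) := fun u => by
    rw [mul_assoc, ← Complex.exp_add]
    ring_nf
  simp_rw [hcongr]
  rw [integral_const_mul, h, Complex.ofReal_zero, mul_zero, Complex.exp_zero, neg_div_neg_eq,
    one_div]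

theorem integral_cpow_mul_exp_left {s : ℂ} (h0 : 0 < s.re) {u : ℝ} (hu : 0 < u) :
    ∫ x in Set.Ioi (0 : ℝ), (x : ℂ) ^ (s - 1) * Complex.exp (-(u * x)) * Complex.exp (-u) =
      Complex.Gamma s * (Real.exp (-u) * (u : ℂ) ^ ((1 - s) - 1)) := by
  have harg : (u : ℂ).arg ≠ Real.pi := by
    rw [Complex.arg_ofReal_of_nonneg hu.le]
    exact Real.pi_pos.ne
  have hsub : 1 - s - 1 = -s := by ring
  rw [integral_mul_const, Complex.integral_cpow_mul_exp_neg_mul_Ioi h0 hu, one_div,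
    Complex.inv_cpow _ _ harg, ← Complex.cpow_neg, hsub]
  push_cast
  ring

theorem mellinConvergent_inv_one_add {s : ℂ} (h0 : 0 < s.re) (h1 : s.re < 1) :
    MellinConvergent (fun x : ℝ => (1 + (x : ℂ))⁻¹) s := by
  refine Integrable.congr (integrable_cpow_mul_exp_prod h0 h1).integral_prod_left ?_
  filter_upwards [ae_restrict_mem measurableSet_Ioi] with x hx
  exact integral_cpow_mul_exp_right s hx

theorem mellin_inv_one_add {s : ℂ} (h0 : 0 < s.re) (h1 : s.re < 1) :
    mellin (fun x : ℝ => (1 + (x : ℂ))⁻¹) s = Complex.Gamma s * Complex.Gamma (1 - s) := by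
  calc mellin (fun x : ℝ => (1 + (x : ℂ))⁻¹) s
      = ∫ x in Set.Ioi (0 : ℝ), ∫ u in Set.Ioi (0 : ℝ),
          (x : ℂ) ^ (s - 1) * Complex.exp (-(u * x)) * Complex.exp (-u) :=
        (setIntegral_congr_fun measurableSet_Ioi fun x hx =>
          integral_cpow_mul_exp_right s hx).symm
    _ = ∫ u in Set.Ioi (0 : ℝ), ∫ x in Set.Ioi (0 : ℝ),
          (x : ℂ) ^ (s - 1) * Complex.exp (-(u * x)) * Complex.exp (-u) :=
        integral_integral_swap (integrable_cpow_mul_exp_prod h0 h1)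
    _ = ∫ u in Set.Ioi (0 : ℝ), Complex.Gamma s * (Real.exp (-u) * (u : ℂ) ^ ((1 - s) - 1)) :=
        setIntegral_congr_fun measurableSet_Ioi fun u hu => integral_cpow_mul_exp_left h0 hu
    _ = Complex.Gamma s * Complex.Gamma (1 - s) := by
        rw [integral_const_mul, Complex.Gamma_eq_integral (s := 1 - s) (by simpa using h1),
          Complex.GammaIntegral]

/-- The Mellin-Barnes kernel `Γ(-w) Γ(1 + w)`, equal to `-π / sin (π w)`. -/
noncomputable def barnesKernel (w : ℂ) : ℂ := Complex.Gamma (-w) * Complex.Gamma (1 + w)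

theorem integrable_barnesKernel {c : ℝ} (h0 : -1 < c) (h1 : c < 0) :
    Integrable fun t : ℝ => barnesKernel (c + t * Complex.I) := by
  have h := (integrable_Gamma_mul_Gamma_one_sub (σ := -c) (by linarith) (by linarith)).comp_neg
  refine h.congr (Filter.Eventually.of_forall fun t => ?_)
  simp only [barnesKernel]
  push_cast
  ring_nf

/-- The Mellin-Barnes representation of `1 / (1 + z)`: Mellin inversion on the line `Re s = -c`,
written in the variable `w = -s`. -/
theorem inv_one_add_eq_integral {c z : ℝ} (h0 : -1 < c) (h1 : c < 0) (hz : 0 < z) :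
    (1 + (z : ℂ))⁻¹ = 1 / (2 * (Real.pi : ℂ)) *
      ∫ t : ℝ, barnesKernel (c + t * Complex.I) * (z : ℂ) ^ (c + t * Complex.I) := by
  have hm : ∀ y : ℝ, mellin (fun x : ℝ => (1 + (x : ℂ))⁻¹) ((-c : ℝ) + y * Complex.I) =
      Complex.Gamma ((-c : ℝ) + y * Complex.I) *
        Complex.Gamma (1 - ((-c : ℝ) + y * Complex.I)) := fun y =>
    mellin_inv_one_add (by simp; linarith) (by simp; linarith)
  have hconv : MellinConvergent (fun x : ℝ => (1 + (x : ℂ))⁻¹) ((-c : ℝ) : ℂ) :=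
    mellinConvergent_inv_one_add (by simp; linarith) (by simp; linarith)
  have hvert : Complex.VerticalIntegrable (mellin fun x : ℝ => (1 + (x : ℂ))⁻¹) (-c) := by
    unfold Complex.VerticalIntegrable
    simp_rw [hm]
    exact integrable_Gamma_mul_Gamma_one_sub (by linarith) (by linarith)
  have hcont : ContinuousAt (fun x : ℝ => (1 + (x : ℂ))⁻¹) z := by
    refine ContinuousAt.inv₀ (by fun_prop) ?_
    exact_mod_cast (by linarith : 1 + z ≠ 0)
  have h := mellinInv_mellin_eq (-c) _ hz hconv hvert hcont
  rw [← h, mellinInv, ← integral_neg_eq_self]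
  simp_rw [hm, Complex.real_smul, smul_eq_mul, barnesKernel]
  push_cast
  congr 1
  refine integral_congr_ae (Filter.Eventually.of_forall fun t => ?_)
  simp only
  ring_nf

/-- Averaging `1 / (1 + β / Y)` under the Mellin-Barnes integral sign. -/
theorem integral_weight_div_one_add_eq {α : Type*} [MeasurableSpace α] {κ : Measure α}
    [SFinite κ] {g Y : α → ℝ} (hg : Measurable g) (hY : Measurable Y)
    (hpos : ∀ᵐ a ∂κ, 0 < Y a) {b c : ℝ} (hb : 0 < b) (h0 : -1 < c) (h1 : c < 0)
    (hint : Integrable (fun a => g a * Y a ^ (-c)) κ) :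
    ((∫ a, g a * (1 + b / Y a)⁻¹ ∂κ : ℝ) : ℂ) = 1 / (2 * (Real.pi : ℂ)) *
      ∫ t : ℝ, barnesKernel (c + t * Complex.I) * (b : ℂ) ^ (c + t * Complex.I) *
        ∫ a, (g a : ℂ) * (Y a : ℂ) ^ (-(c + t * Complex.I)) ∂κ := by
  set k : ℝ → ℂ := fun t => barnesKernel (c + t * Complex.I) * (b : ℂ) ^ (c + t * Complex.I)
    with hk
  have hbw : ∀ t : ℝ, ‖(b : ℂ) ^ (c + t * Complex.I)‖ = b ^ c := fun t => by
    rw [Complex.norm_cpow_eq_rpow_re_of_pos hb]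
    simp
  have hb0 : (b : ℂ) ≠ 0 := by exact_mod_cast hb.ne'
  have hkint : Integrable k := by
    refine (integrable_barnesKernel h0 h1).mul_bdd (c := b ^ c)
      (Continuous.aestronglyMeasurable ?_)
      (Filter.Eventually.of_forall fun t => (hbw t).le)
    exact Continuous.const_cpow (by fun_prop) (Or.inl hb0)
  have hprod : Integrable (Function.uncurry fun (a : α) (t : ℝ) =>
      k t * ((g a : ℂ) * (Y a : ℂ) ^ (-(c + t * Complex.I)))) (κ.prod volume) := by
    refine (hint.ofReal (𝕜 := ℂ).mul_prod hkint).mono ?_ ?_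
    · refine AEStronglyMeasurable.mul hkint.aestronglyMeasurable.comp_snd
        (Measurable.aestronglyMeasurable ?_)
      fun_prop
    · have := Measure.quasiMeasurePreserving_fst (μ := κ) (ν := (volume : Measure ℝ)) |>.ae hpos
      filter_upwards [this] with p hp
      simp only [Function.uncurry, norm_mul, Complex.norm_cpow_eq_rpow_re_of_pos hp]
      simp [abs_of_pos (Real.rpow_pos_of_pos hp _), mul_comm]
  have hpt : ∀ᵐ a ∂κ, ((g a * (1 + b / Y a)⁻¹ : ℝ) : ℂ) = 1 / (2 * (Real.pi : ℂ)) *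
      ∫ t : ℝ, k t * ((g a : ℂ) * (Y a : ℂ) ^ (-(c + t * Complex.I))) := by
    filter_upwards [hpos] with a ha
    have ha0 : (Y a : ℂ) ≠ 0 := by exact_mod_cast ha.ne'
    have h := inv_one_add_eq_integral h0 h1 (div_pos hb ha)
    push_cast at h ⊢
    rw [h, mul_left_comm, ← integral_const_mul]
    congr 1
    refine integral_congr_ae (Filter.Eventually.of_forall fun t => ?_)
    have : ((b : ℂ) / Y a) ^ (c + t * Complex.I) =
        (b : ℂ) ^ (c + t * Complex.I) * (Y a : ℂ) ^ (-(c + t * Complex.I)) := by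
      rw [div_eq_mul_inv, ← Complex.ofReal_inv, Complex.mul_cpow_ofReal_nonneg hb.le
        (inv_nonneg.2 ha.le), Complex.ofReal_inv, Complex.inv_cpow _ _
        (by rw [Complex.arg_ofReal_of_nonneg ha.le]; exact Real.pi_pos.ne), Complex.cpow_neg]
    simp only [this, hk]
    ring
  rw [← integral_complex_ofReal, integral_congr_ae hpt, integral_const_mul,
    integral_integral_swap hprod]
  simp_rw [integral_const_mul]
  rfl

/-! ### The Meijer function as a double integral -/

theorem integral_cpow_sub_mul_exp_neg {a w : ℂ} (h : 0 < (a - w).re) :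
    ∫ x in Set.Ioi (0 : ℝ), (x : ℂ) ^ (a - 1 - w) * Real.exp (-x) = Complex.Gamma (a - w) := by
  rw [Complex.Gamma_eq_integral h, Complex.GammaIntegral]
  refine setIntegral_congr_fun measurableSet_Ioi fun x _ => ?_
  rw [mul_comm, sub_right_comm]

/-- The integral of `x^n e^(-x) J k (b / x)` over `x > 0`, where `J = gammaStieltjes`, as a
Mellin-Barnes integral: write it as a double integral and expand `1 / (1 + b / (x t))`. -/
theorem integral_gammaStieltjes_eq_barnes (n k : ℕ) {b c : ℝ} (hb : 0 < b) (h0 : -1 < c)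
    (h1 : c < 0) :
    ((∫ x in Set.Ioi (0 : ℝ), x ^ n * Real.exp (-x) * gammaStieltjes k (b / x) : ℝ) : ℂ) =
      1 / (2 * (Real.pi : ℂ)) * ∫ t : ℝ, barnesKernel (c + t * Complex.I) *
        (b : ℂ) ^ (c + t * Complex.I) * (Complex.Gamma (n + 1 - (c + t * Complex.I)) *
          Complex.Gamma (k - (c + t * Complex.I))) := by
  set μ := volume.restrict (Set.Ioi (0 : ℝ)) with hμ
  -- For `k = 0` the weight `t^(k-1) e^(-t)` is not integrable at `0`; the factor `(x t)^(-c)` with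
  -- `c < 0` restores integrability.
  set g : ℝ × ℝ → ℝ := fun p => p.1 ^ n * Real.exp (-p.1) *
    (p.2 ^ ((k : ℝ) - 1) * Real.exp (-p.2)) with hg
  set Y : ℝ × ℝ → ℝ := fun p => p.1 * p.2 with hY
  have hpos : ∀ᵐ p ∂μ.prod μ, 0 < p.1 ∧ 0 < p.2 := by
    rw [hμ, Measure.prod_restrict]
    filter_upwards [ae_restrict_mem (measurableSet_Ioi.prod measurableSet_Ioi)] with p hp
    exact hp
  have hYpos : ∀ᵐ p ∂μ.prod μ, 0 < Y p := by
    filter_upwards [hpos] with p hp using mul_pos hp.1 hp.2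
  have hgm : Measurable g := by
    unfold g
    fun_prop
  have hYm : Measurable Y := by
    unfold Y
    fun_prop
  have hint : Integrable (fun p => g p * Y p ^ (-c)) (μ.prod μ) := by
    have hx := Real.GammaIntegral_convergent (s := (n : ℝ) + 1 - c) (by
      have := n.cast_nonneg (α := ℝ)
      linarith)
    have ht := Real.GammaIntegral_convergent (s := (k : ℝ) - c) (by
      have := k.cast_nonneg (α := ℝ)
      linarith)
    refine (hx.mul_prod ht).congr ?_
    filter_upwards [hpos] with p hp
    have e1 : (n : ℝ) + 1 - c - 1 = n + -c := by ring
    have e2 : (k : ℝ) - c - 1 = (k - 1) + -c := by ring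
    simp only [hg, hY]
    rw [e1, e2, Real.rpow_add hp.1, Real.rpow_add hp.2, Real.mul_rpow hp.1.le hp.2.le,
      Real.rpow_natCast]
    ring
  have hmain := integral_weight_div_one_add_eq hgm hYm hYpos hb h0 h1 hint
  have hlhs_pt : ∀ x t : ℝ, 0 < x → 0 < t → g (x, t) * (1 + b / Y (x, t))⁻¹ =
      x ^ n * Real.exp (-x) * (t ^ k * Real.exp (-t) / (b / x + t)) := fun x t hx ht => by
    simp only [hg, hY]
    rw [Real.rpow_sub ht, Real.rpow_natCast, Real.rpow_one]
    field_simp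
    ring
  have hlhs_int : Integrable (fun p => g p * (1 + b / Y p)⁻¹) (μ.prod μ) := by
    have hx := (integrableOn_pow_mul_exp_neg (n + 1)).div_const b
    have ht := integrableOn_pow_mul_exp_neg k
    refine (hx.mul_prod ht).mono' (Measurable.aestronglyMeasurable (by fun_prop)) ?_
    filter_upwards [hpos] with p hp
    obtain ⟨hp1, hp2⟩ := hp
    have := hlhs_pt p.1 p.2 hp1 hp2
    rw [Prod.mk.eta] at this
    rw [this, Real.norm_of_nonneg (by positivity)]
    calc p.1 ^ n * Real.exp (-p.1) * (p.2 ^ k * Real.exp (-p.2) / (b / p.1 + p.2))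
        ≤ p.1 ^ n * Real.exp (-p.1) * (p.2 ^ k * Real.exp (-p.2) / (b / p.1)) := by
          gcongr
          linarith
      _ = _ := by
          field_simp
          ring
  have hlhs : ∫ p, g p * (1 + b / Y p)⁻¹ ∂μ.prod μ =
      ∫ x in Set.Ioi (0 : ℝ), x ^ n * Real.exp (-x) * gammaStieltjes k (b / x) := by
    rw [integral_prod _ hlhs_int]
    refine setIntegral_congr_fun measurableSet_Ioi fun x hx => ?_
    simp only [gammaStieltjes]
    rw [← integral_const_mul]
    exact setIntegral_congr_fun measurableSet_Ioi fun t ht => hlhs_pt x t hx ht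
  rw [← hlhs, hmain]
  congr 1
  refine integral_congr_ae (Filter.Eventually.of_forall fun y => ?_)
  simp only
  congr 1
  set w : ℂ := c + y * Complex.I with hw
  have hwre : w.re = c := by simp [hw]
  rw [← integral_cpow_sub_mul_exp_neg (a := n + 1) (w := w) (by
      have := n.cast_nonneg (α := ℝ)
      simp [hwre]
      linarith),
    ← integral_cpow_sub_mul_exp_neg (a := k) (w := w) (by
      have := k.cast_nonneg (α := ℝ)
      simp [hwre]
      linarith),
    ← integral_prod_mul]
  refine integral_congr_ae ?_
  filter_upwards [hpos] with p hp
  obtain ⟨hp1, hp2⟩ := hp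
  have hp1' : (p.1 : ℂ) ≠ 0 := by exact_mod_cast hp1.ne'
  have hp2' : (p.2 : ℂ) ≠ 0 := by exact_mod_cast hp2.ne'
  simp only [hg, hY]
  rw [sub_eq_add_neg _ w, sub_eq_add_neg _ w, add_sub_cancel_right, Complex.cpow_add _ _ hp1',
    Complex.cpow_add _ _ hp2', Complex.cpow_natCast, Complex.ofReal_mul p.1 p.2,
    Complex.mul_cpow_ofReal_nonneg hp1.le hp2.le]
  push_cast [Complex.ofReal_cpow hp2.le]
  ring

/-- The Meijer functions of the capacity formula. The contour of `meijerG` is an unspecified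
separating line; the integral representation holds for each of them. -/
theorem pow_mul_meijerG_eq (n k : ℕ) (hk : k ≤ n) {b : ℝ} (hb : 0 < b) :
    (b : ℂ) ^ k * meijerG 3 1 ![-(k : ℂ)] ![-(k : ℂ), ((n + 1 : ℕ) : ℂ) - (k : ℂ), 0] (b : ℂ) =
      ((∫ x in Set.Ioi (0 : ℝ), x ^ n * Real.exp (-x) * gammaStieltjes k (b / x) : ℝ) : ℂ) := by
  have hk' : (k : ℝ) ≤ n := by exact_mod_cast hk
  have hk0 : (0 : ℝ) ≤ k := k.cast_nonneg
  have hiff : ∀ c : ℝ, MeijerSeparates 3 1 ![-(k : ℂ)]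
      ![-(k : ℂ), ((n + 1 : ℕ) : ℂ) - (k : ℂ), 0] c ↔ -1 < c + k ∧ c + k < 0 := fun c => by
    simp only [MeijerSeparates, Fin.forall_fin_succ]
    simp
    constructor
    · rintro ⟨h1, h2, -⟩
      constructor <;> linarith
    · rintro ⟨h1, h2⟩
      refine ⟨?_, ?_, ?_, ?_⟩ <;> linarith
  have hex : ∃ c : ℝ, MeijerSeparates 3 1 ![-(k : ℂ)]
      ![-(k : ℂ), ((n + 1 : ℕ) : ℂ) - (k : ℂ), 0] c :=
    ⟨-k - 1 / 2, (hiff _).2 (by constructor <;> linarith)⟩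
  rw [meijerG, dif_pos hex]
  obtain ⟨h0, h1⟩ := (hiff _).1 hex.choose_spec
  generalize hex.choose = c at h0 h1
  rw [integral_gammaStieltjes_eq_barnes n k hb h0 h1, mul_left_comm, ← integral_const_mul]
  congr 1
  refine integral_congr_ae (Filter.Eventually.of_forall fun t => ?_)
  have hb0 : (b : ℂ) ≠ 0 := by exact_mod_cast hb.ne'
  have hw : ((c + k : ℝ) : ℂ) + t * Complex.I = (c + t * Complex.I) + k := by
    push_cast
    ring
  -- There are no gamma factors in the denominator, as `m = q = 3` and `n = p = 1`.
  have hnum : (Finset.univ.filter fun j : Fin 3 => (j : ℕ) < 3) = Finset.univ :=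
    Finset.filter_true_of_mem fun j _ => j.2
  have hnum' : (Finset.univ.filter fun j : Fin 1 => (j : ℕ) < 1) = Finset.univ :=
    Finset.filter_true_of_mem fun j _ => j.2
  have hden : (Finset.univ.filter fun j : Fin 3 => 3 ≤ (j : ℕ)) = ∅ :=
    Finset.filter_false_of_mem fun j _ => not_le.2 j.2
  have hden' : (Finset.univ.filter fun j : Fin 1 => 1 ≤ (j : ℕ)) = ∅ :=
    Finset.filter_false_of_mem fun j _ => not_le.2 j.2
  simp only [hw, meijerIntegrand, barnesKernel, hnum, hnum', hden, hden', Finset.prod_empty,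
    Fin.prod_univ_three, Fin.prod_univ_one, Matrix.cons_val]
  rw [Complex.cpow_add _ (k : ℂ) hb0, Complex.cpow_natCast]
  push_cast
  ring_nf

/-! ### The product of two Gamma variables -/

theorem gammaStieltjes_nonneg (k : ℕ) {a : ℝ} (ha : 0 < a) : 0 ≤ gammaStieltjes k a :=
  setIntegral_nonneg measurableSet_Ioi fun t ht => by
    have ht : 0 < t := ht
    positivity

theorem gammaStieltjes_le (k : ℕ) {a : ℝ} (ha : 0 < a) :
    gammaStieltjes k a ≤ k.factorial / a := by
  rw [← integral_pow_mul_exp_neg, ← integral_div]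
  refine setIntegral_mono_on (integrableOn_gammaStieltjes k ha)
    ((integrableOn_pow_mul_exp_neg k).div_const a) measurableSet_Ioi fun t ht => ?_
  have ht : 0 < t := ht
  gcongr
  linarith

theorem measurable_gammaStieltjes (k : ℕ) : Measurable (gammaStieltjes k) := by
  have : Measurable fun p : ℝ × ℝ => p.2 ^ k * Real.exp (-p.2) / (p.1 + p.2) := by fun_prop
  exact (this.stronglyMeasurable.integral_prod_right'
    (ν := volume.restrict (Set.Ioi (0 : ℝ)))).measurable

theorem integrable_gammaStieltjes_div (n k : ℕ) {b : ℝ} (hb : 0 < b) :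
    Integrable (fun x => gammaStieltjes k (b / x)) (gammaMeasure (n + 1) 1) := by
  refine ((integrable_id_gammaMeasure n).const_mul (k.factorial / b)).mono'
    ((measurable_gammaStieltjes k).comp (by fun_prop)).aestronglyMeasurable ?_
  filter_upwards [ae_pos_gammaMeasure n] with x hx
  rw [Real.norm_of_nonneg (gammaStieltjes_nonneg k (div_pos hb hx))]
  refine (gammaStieltjes_le k (div_pos hb hx)).trans (le_of_eq ?_)
  field_simp

theorem integrable_log_one_add_mul_div (n : ℕ) {b : ℝ} (hb : 0 < b) :
    Integrable (fun p : ℝ × ℝ => Real.log (1 + p.1 * p.2 / b))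
      ((gammaMeasure (n + 1) 1).prod (gammaMeasure (n + 1) 1)) := by
  have := isProbabilityMeasure_gammaMeasure (a := n + 1) (r := 1) (by positivity) one_pos
  have h1 := Measure.quasiMeasurePreserving_fst (μ := gammaMeasure (n + 1) 1)
    (ν := gammaMeasure (n + 1) 1) |>.ae (ae_pos_gammaMeasure n)
  have h2 := Measure.quasiMeasurePreserving_snd (μ := gammaMeasure (n + 1) 1)
    (ν := gammaMeasure (n + 1) 1) |>.ae (ae_pos_gammaMeasure n)
  refine (((integrable_id_gammaMeasure n).mul_prod (integrable_id_gammaMeasure n)).div_const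
    b).mono' (Measurable.aestronglyMeasurable (by fun_prop)) ?_
  filter_upwards [h1, h2] with p hp1 hp2
  have hp : 0 < p.1 * p.2 := mul_pos hp1 hp2
  rw [Real.norm_of_nonneg (Real.log_nonneg (by linarith [div_pos hp hb]))]
  exact log_one_add_div_le hb hp.le

/-- The expectation of `log (1 + X₁ X₂ / b)`, by conditioning on the second variable. -/
theorem integral_log_one_add_mul_div (n : ℕ) {b : ℝ} (hb : 0 < b) :
    ∫ p : ℝ × ℝ, Real.log (1 + p.1 * p.2 / b)
        ∂(gammaMeasure (n + 1) 1).prod (gammaMeasure (n + 1) 1) =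
      (n.factorial : ℝ)⁻¹ * ∑ k ∈ Finset.range (n + 1), (k.factorial : ℝ)⁻¹ *
        ∫ x in Set.Ioi (0 : ℝ), x ^ n * Real.exp (-x) * gammaStieltjes k (b / x) := by
  have := isProbabilityMeasure_gammaMeasure (a := n + 1) (r := 1) (by positivity) one_pos
  have hinner : ∀ᵐ y ∂gammaMeasure (n + 1) 1,
      ∫ x, Real.log (1 + x * y / b) ∂gammaMeasure (n + 1) 1 =
        ∑ k ∈ Finset.range (n + 1), (k.factorial : ℝ)⁻¹ * gammaStieltjes k (b / y) := by
    filter_upwards [ae_pos_gammaMeasure n] with y hy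
    rw [← integral_log_one_add_div_gammaMeasure n (div_pos hb hy)]
    congr 1
    ext x
    rw [div_div_eq_mul_div]
  rw [integral_prod_symm _ (integrable_log_one_add_mul_div n hb)]
  rw [integral_congr_ae hinner, integral_finsetSum _
    fun k _ => (integrable_gammaStieltjes_div n k hb).const_mul _, Finset.mul_sum]
  refine Finset.sum_congr rfl fun k _ => ?_
  rw [integral_const_mul, integral_gammaMeasure]
  simp only [smul_eq_mul]
  ring

/-- The capacity bound for a scalar two-hop chain: `1 + U V / (1 + U + V)` factors as
`(1 + U) (1 + V) / (1 + U + V)`, and Jensen's inequality applies to the denominator. -/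
theorem integral_log_one_add_harmonic_le {Ω : Type*} [MeasurableSpace Ω] {P : Measure Ω}
    [IsProbabilityMeasure P] {U V : Ω → ℝ} (hUm : AEMeasurable U P) (hVm : AEMeasurable V P)
    (hUpos : ∀ᵐ ω ∂P, 0 < U ω) (hVpos : ∀ᵐ ω ∂P, 0 < V ω)
    (hU : Integrable (fun ω => Real.log (1 + U ω)) P)
    (hV : Integrable (fun ω => Real.log (1 + V ω)) P)
    (hlU : Integrable (fun ω => Real.log (U ω)) P)
    (hlV : Integrable (fun ω => Real.log (V ω)) P) :
    Integrable (fun ω => Real.log (1 + U ω * V ω / (1 + U ω + V ω))) P ∧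
      ∫ ω, Real.log (1 + U ω * V ω / (1 + U ω + V ω)) ∂P ≤
        (∫ ω, Real.log (1 + U ω) ∂P) + (∫ ω, Real.log (1 + V ω) ∂P) -
          Real.log (1 + Real.exp (∫ ω, Real.log (U ω) ∂P) +
            Real.exp (∫ ω, Real.log (V ω) ∂P)) := by
  have hW : Integrable (fun ω => Real.log (1 + U ω + V ω)) P := by
    refine (hU.add hV).mono' (AEMeasurable.aestronglyMeasurable (by fun_prop)) ?_
    filter_upwards [hUpos, hVpos] with ω h1 h2
    rw [Real.norm_of_nonneg (Real.log_nonneg (by linarith)), Pi.add_apply,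
      ← Real.log_mul (by positivity) (by positivity)]
    refine Real.log_le_log (by positivity) ?_
    nlinarith [mul_pos h1 h2]
  have heq : (fun ω => Real.log (1 + U ω) + Real.log (1 + V ω) - Real.log (1 + U ω + V ω))
      =ᵐ[P] fun ω => Real.log (1 + U ω * V ω / (1 + U ω + V ω)) := by
    filter_upwards [hUpos, hVpos] with ω h1 h2
    rw [← Real.log_mul (by positivity) (by positivity), ← Real.log_div (by positivity)
      (by positivity)]
    congr 1
    field_simp
    ring
  refine ⟨((hU.add hV).sub hW).congr heq, ?_⟩
  have hexp : (fun ω => Real.log (1 + U ω + V ω)) =ᵐ[P]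
      fun ω => Real.log (1 + Real.exp (Real.log (U ω)) + Real.exp (Real.log (V ω))) := by
    filter_upwards [hUpos, hVpos] with ω h1 h2
    rw [Real.exp_log h1, Real.exp_log h2]
  have hJ := log_one_add_exp_integral_le P hlU hlV (hW.congr hexp)
  rw [← integral_congr_ae hexp] at hJ
  rw [← integral_congr_ae heq, integral_sub (by exact hU.add hV) hW, integral_add hU hV]
  linarith

/-! ### The closed forms and the bound -/

namespace System

variable {S : System} {N : ℕ}

theorem Admissible.rho_pos (hS : S.Admissible) : 0 < S.rho := div_pos hS.1 hS.2.1

theorem Admissible.alpha_pos (hS : S.Admissible) : 0 < S.alpha := by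
  have hρ := hS.rho_pos
  obtain ⟨hPs, hN0, hT, hd1, hd2, hη, hθ, hθ1⟩ := hS
  have : 0 < 1 - S.θ := by linarith
  unfold alpha
  positivity

theorem Admissible.beta_pos (hS : S.Admissible) : 0 < S.beta := by
  have hρ := hS.rho_pos
  obtain ⟨hPs, hN0, hT, hd1, hd2, hη, hθ, hθ1⟩ := hS
  unfold beta
  positivity

theorem inv_alpha : S.alpha⁻¹ = (1 - S.θ) * S.rho / S.d1 ^ S.τ := inv_div _ _

theorem inv_beta : S.beta⁻¹ = S.η * S.θ * S.rho / (S.d1 ^ S.τ * S.d2 ^ S.τ) := inv_div _ _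

theorem gamma1_eq (h₁ : Fin N → ℂ) : S.gamma1 h₁ = normSq h₁ / S.alpha := by
  rw [gamma1, ← inv_alpha]
  ring

theorem gamma2_eq (h₁ h₂ : Fin N → ℂ) :
    S.gamma2 h₁ h₂ = normSq h₁ * normSq h₂ / S.beta := by
  rw [gamma2, ← inv_beta]
  ring

theorem closedC1_eq (hS : S.Admissible) (n : ℕ) :
    S.closedC1 (n + 1) = 1 / 2 * ((∑ k ∈ Finset.range (n + 1),
      (k.factorial : ℝ)⁻¹ * gammaStieltjes k S.alpha) / Real.log 2) := by
  have hsum : ∀ k ∈ Finset.range (n + 1), (k.factorial : ℝ)⁻¹ * gammaStieltjes k S.alpha =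
      Real.exp S.alpha * (S.alpha ^ k * upperGamma (-(k : ℝ)) S.alpha) := fun k _ => by
    have : (k.factorial : ℝ) ≠ 0 := by exact_mod_cast k.factorial_ne_zero
    rw [gammaStieltjes_eq_upperGamma k hS.alpha_pos, inv_mul_cancel_left₀ this]
  rw [Finset.sum_congr rfl hsum, ← Finset.mul_sum, closedC1]
  ring

theorem closedC2_eq (hS : S.Admissible) (n : ℕ) :
    S.closedC2 (n + 1) = ((1 / 2 * ((n.factorial : ℝ)⁻¹ * (∑ k ∈ Finset.range (n + 1),
      (k.factorial : ℝ)⁻¹ * ∫ x in Set.Ioi (0 : ℝ),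
        x ^ n * Real.exp (-x) * gammaStieltjes k (S.beta / x)) / Real.log 2) : ℝ) : ℂ) := by
  have hsum : ∀ k ∈ Finset.range (n + 1), 1 / (k.factorial : ℂ) * (S.beta : ℂ) ^ k *
      meijerG 3 1 ![-(k : ℂ)] ![-(k : ℂ), ((n + 1 : ℕ) : ℂ) - (k : ℂ), 0] (S.beta : ℂ) =
      (((k.factorial : ℝ)⁻¹ * ∫ x in Set.Ioi (0 : ℝ),
        x ^ n * Real.exp (-x) * gammaStieltjes k (S.beta / x) : ℝ) : ℂ) := fun k hk => by
    rw [mul_assoc, pow_mul_meijerG_eq n k (Nat.lt_succ_iff.1 (Finset.mem_range.1 hk)) hS.beta_pos]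
    push_cast
    ring
  have hG : Complex.Gamma ((n + 1 : ℕ) : ℂ) = n.factorial := by
    push_cast
    exact Complex.Gamma_nat_eq_factorial n
  rw [closedC2, Finset.sum_congr rfl hsum, ← Complex.ofReal_sum, hG]
  push_cast
  ring

end System

theorem ergodicCapacity_eq {Ω : Type*} [MeasurableSpace Ω] (P : Measure Ω) (γ : Ω → ℝ) :
    ergodicCapacity P γ = 1 / 2 * ((∫ ω, Real.log (1 + γ ω) ∂P) / Real.log 2) := by
  simp only [ergodicCapacity, Real.logb]
  rw [integral_div]

end EHRelay

theorem theorem3 {Ω : Type*} [MeasurableSpace Ω] (P : Measure Ω) [IsProbabilityMeasure P]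
    (S : System) (hS : S.Admissible) (N : ℕ) (hN : 1 ≤ N)
    -- the `2N` channel coefficients are i.i.d. `CN(0,1)`
    (h₁ h₂ : Fin N → Ω → ℂ)
    (hlaw₁ : ∀ i, HasLaw (h₁ i) complexNormal P)
    (hlaw₂ : ∀ i, HasLaw (h₂ i) complexNormal P)
    (hindep : iIndepFun (Sum.elim h₁ h₂ : Fin N ⊕ Fin N → Ω → ℂ) P)
    -- the random SNR `γ` and its components `γ₁`, `γ₂`, and the squared channel norms
    (γ γ₁ γ₂ X₁ X₂ : Ω → ℝ)
    (hγ : γ = fun ω => S.snr (fun i => h₁ i ω) (fun i => h₂ i ω))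
    (hγ₁ : γ₁ = fun ω => S.gamma1 (fun i => h₁ i ω))
    (hγ₂ : γ₂ = fun ω => S.gamma2 (fun i => h₁ i ω) (fun i => h₂ i ω))
    (hX₁ : X₁ = fun ω => normSq (fun i => h₁ i ω))
    (hX₂ : X₂ = fun ω => normSq (fun i => h₂ i ω)) :
    -- all the expectations exist
    (Integrable (fun ω => Real.logb 2 (1 + γ ω)) P ∧
      Integrable (fun ω => Real.logb 2 (1 + γ₁ ω)) P ∧
      Integrable (fun ω => Real.logb 2 (1 + γ₂ ω)) P ∧
      Integrable (fun ω => Real.log (γ₁ ω)) P ∧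
      Integrable (fun ω => Real.log (γ₂ ω)) P ∧
      Integrable (fun ω => Real.log (X₁ ω)) P ∧
      Integrable (fun ω => Real.log (X₂ ω)) P) ∧
    -- the closed-form upper bound on the ergodic capacity
    ergodicCapacity P γ ≤ S.capacityBound N ∧
    -- its form
    S.capacityBound N = ergodicCapacity P γ₁ + ergodicCapacity P γ₂ -
      1 / 2 * Real.logb 2 (1 + Real.exp (∫ ω, Real.log (γ₁ ω) ∂P) +
        Real.exp (∫ ω, Real.log (γ₂ ω) ∂P)) ∧
    -- its constituents
    ergodicCapacity P γ₁ = S.closedC1 N ∧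
    (ergodicCapacity P γ₂ : ℂ) = S.closedC2 N ∧
    ∫ ω, Real.log (X₁ ω) ∂P = System.psi N ∧
    ∫ ω, Real.log (X₂ ω) ∂P = System.psi N := by
  obtain ⟨n, rfl⟩ : ∃ n, N = n + 1 := ⟨N - 1, by omega⟩
  have hα := hS.alpha_pos
  have hβ := hS.beta_pos
  have hprob := isProbabilityMeasure_gammaMeasure (a := n + 1) (r := 1) (by positivity) one_pos
  have hX₁law : HasLaw X₁ (gammaMeasure (n + 1) 1) P := by
    rw [hX₁]
    exact hasLaw_normSq hlaw₁ (iIndepFun.precomp (f := Sum.elim h₁ h₂) Sum.inl_injective hindep)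
  have hX₂law : HasLaw X₂ (gammaMeasure (n + 1) 1) P := by
    rw [hX₂]
    exact hasLaw_normSq hlaw₂ (iIndepFun.precomp (f := Sum.elim h₁ h₂) Sum.inr_injective hindep)
  have hXlaw : HasLaw (fun ω => (X₁ ω, X₂ ω))
      ((gammaMeasure (n + 1) 1).prod (gammaMeasure (n + 1) 1)) P := by
    rw [hX₁, hX₂]
    exact hasLaw_normSq_prod hlaw₁ hlaw₂ hindep
  have hγ₁' : γ₁ = fun ω => X₁ ω / S.alpha := by
    rw [hγ₁, hX₁]
    exact funext fun ω => System.gamma1_eq _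
  have hγ₂' : γ₂ = fun ω => X₁ ω * X₂ ω / S.beta := by
    rw [hγ₂, hX₁, hX₂]
    exact funext fun ω => System.gamma2_eq _ _
  have hγ' : γ = fun ω => γ₁ ω * γ₂ ω / (1 + γ₁ ω + γ₂ ω) := by
    rw [hγ, hγ₁, hγ₂]
    exact funext fun ω => S.snr_eq hS _ _
  have hX₁m := hX₁law.aemeasurable
  have hX₂m := hX₂law.aemeasurable
  have hX₁pos : ∀ᵐ ω ∂P, 0 < X₁ ω :=
    (hX₁law.ae_iff (p := fun x => 0 < x) (by measurability)).2 (ae_pos_gammaMeasure n)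
  have hX₂pos : ∀ᵐ ω ∂P, 0 < X₂ ω :=
    (hX₂law.ae_iff (p := fun x => 0 < x) (by measurability)).2 (ae_pos_gammaMeasure n)
  have hlX₁ : Integrable (fun ω => Real.log (X₁ ω)) P :=
    (hX₁law.map_eq ▸ integrable_log_gammaMeasure n :
      Integrable Real.log (P.map X₁)).comp_aemeasurable hX₁m
  have hlX₂ : Integrable (fun ω => Real.log (X₂ ω)) P :=
    (hX₂law.map_eq ▸ integrable_log_gammaMeasure n :
      Integrable Real.log (P.map X₂)).comp_aemeasurable hX₂m
  have hEX₁ : ∫ ω, Real.log (X₁ ω) ∂P = System.psi (n + 1) :=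
    (hX₁law.integral_comp Real.measurable_log.aestronglyMeasurable).trans
      (integral_log_gammaMeasure n)
  have hEX₂ : ∫ ω, Real.log (X₂ ω) ∂P = System.psi (n + 1) :=
    (hX₂law.integral_comp Real.measurable_log.aestronglyMeasurable).trans
      (integral_log_gammaMeasure n)
  have hL₁ : Integrable (fun ω => Real.log (1 + γ₁ ω)) P := by
    rw [hγ₁']
    exact (hX₁law.map_eq ▸ integrable_log_one_add_div_gammaMeasure n hα :
      Integrable (fun x => Real.log (1 + x / S.alpha)) (P.map X₁)).comp_aemeasurable hX₁m
  have hL₂ : Integrable (fun ω => Real.log (1 + γ₂ ω)) P := by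
    rw [hγ₂']
    exact (hXlaw.map_eq ▸ integrable_log_one_add_mul_div n hβ :
      Integrable (fun p : ℝ × ℝ => Real.log (1 + p.1 * p.2 / S.beta))
        (P.map fun ω => (X₁ ω, X₂ ω))).comp_aemeasurable hXlaw.aemeasurable
  have hEL₁ : ∫ ω, Real.log (1 + γ₁ ω) ∂P =
      ∑ k ∈ Finset.range (n + 1), (k.factorial : ℝ)⁻¹ * gammaStieltjes k S.alpha := by
    rw [← integral_log_one_add_div_gammaMeasure n hα, hγ₁']
    exact hX₁law.integral_comp (f := fun x => Real.log (1 + x / S.alpha))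
      (Measurable.aestronglyMeasurable (by fun_prop))
  have hEL₂ : ∫ ω, Real.log (1 + γ₂ ω) ∂P = (n.factorial : ℝ)⁻¹ *
      ∑ k ∈ Finset.range (n + 1), (k.factorial : ℝ)⁻¹ *
        ∫ x in Set.Ioi (0 : ℝ), x ^ n * Real.exp (-x) * gammaStieltjes k (S.beta / x) := by
    rw [← integral_log_one_add_mul_div n hβ, hγ₂']
    exact hXlaw.integral_comp (f := fun p : ℝ × ℝ => Real.log (1 + p.1 * p.2 / S.beta))
      (Measurable.aestronglyMeasurable (by fun_prop))
  have hlog₁ : (fun ω => Real.log (X₁ ω) + Real.log S.alpha⁻¹) =ᵐ[P]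
      fun ω => Real.log (γ₁ ω) := by
    filter_upwards [hX₁pos] with ω h
    rw [hγ₁', ← Real.log_mul h.ne' (inv_pos.2 hα).ne']
    simp only [div_eq_mul_inv]
  have hlog₂ : (fun ω => Real.log (X₁ ω) + Real.log (X₂ ω) + Real.log S.beta⁻¹) =ᵐ[P]
      fun ω => Real.log (γ₂ ω) := by
    filter_upwards [hX₁pos, hX₂pos] with ω h h'
    rw [hγ₂', ← Real.log_mul h.ne' h'.ne', ← Real.log_mul (mul_pos h h').ne' (inv_pos.2 hβ).ne']
    simp only [div_eq_mul_inv]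
  have hlγ₁ : Integrable (fun ω => Real.log (γ₁ ω)) P :=
    (hlX₁.add (integrable_const _)).congr hlog₁
  have hlγ₂ : Integrable (fun ω => Real.log (γ₂ ω)) P :=
    ((hlX₁.add hlX₂).add (integrable_const _)).congr hlog₂
  have hexp₁ : Real.exp (∫ ω, Real.log (γ₁ ω) ∂P) =
      S.alpha⁻¹ * Real.exp (System.psi (n + 1)) := by
    rw [← integral_congr_ae hlog₁, integral_add hlX₁ (integrable_const _), hEX₁, Real.exp_add]
    simp [Real.exp_log hα, Real.exp_neg, mul_comm]
  have hexp₂ : Real.exp (∫ ω, Real.log (γ₂ ω) ∂P) =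
      S.beta⁻¹ * Real.exp (2 * System.psi (n + 1)) := by
    rw [← integral_congr_ae hlog₂, integral_add (by exact hlX₁.add hlX₂) (integrable_const _),
      integral_add hlX₁ hlX₂, hEX₁, hEX₂, Real.exp_add, ← two_mul]
    simp [Real.exp_log hβ, Real.exp_neg, mul_comm]
  have hγ₁pos : ∀ᵐ ω ∂P, 0 < γ₁ ω := by
    filter_upwards [hX₁pos] with ω h
    rw [hγ₁']
    exact div_pos h hα
  have hγ₂pos : ∀ᵐ ω ∂P, 0 < γ₂ ω := by
    filter_upwards [hX₁pos, hX₂pos] with ω h h'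
    rw [hγ₂']
    exact div_pos (mul_pos h h') hβ
  obtain ⟨hL, hbound⟩ := integral_log_one_add_harmonic_le (P := P)
    (by rw [hγ₁']; fun_prop) (by rw [hγ₂']; fun_prop) hγ₁pos hγ₂pos hL₁ hL₂ hlγ₁ hlγ₂
  have hC₁ : ergodicCapacity P γ₁ = S.closedC1 (n + 1) := by
    rw [ergodicCapacity_eq, hEL₁, System.closedC1_eq hS]
  have hC₂ : (ergodicCapacity P γ₂ : ℂ) = S.closedC2 (n + 1) := by
    rw [ergodicCapacity_eq, hEL₂, System.closedC2_eq hS]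
  -- `closedC2` is a complex number; it is real because it equals an ergodic capacity.
  have hform : S.capacityBound (n + 1) = ergodicCapacity P γ₁ + ergodicCapacity P γ₂ -
      1 / 2 * Real.logb 2 (1 + Real.exp (∫ ω, Real.log (γ₁ ω) ∂P) +
        Real.exp (∫ ω, Real.log (γ₂ ω) ∂P)) := by
    rw [System.capacityBound, hexp₁, hexp₂, hC₁, ← hC₂, Complex.ofReal_re, System.inv_alpha,
      System.inv_beta]
  refine ⟨⟨?_, hL₁.div_const _, hL₂.div_const _, hlγ₁, hlγ₂, hlX₁, hlX₂⟩, ?_, hform, hC₁, hC₂,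
    hEX₁, hEX₂⟩
  · rw [hγ']
    exact hL.div_const _
  · have hlog2 : 0 < Real.log 2 := Real.log_pos one_lt_two
    rw [hform, ergodicCapacity_eq, ergodicCapacity_eq, ergodicCapacity_eq, Real.logb, hγ',
      ← mul_add, ← mul_sub, ← add_div, ← sub_div]
    gcongr
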